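/- Let $1<\alpha<\beta<\infty$, $\Omega=(-\infty,0)\cup(1,\alpha)\cup(\beta,\infty)$ and $e(x)=e^{2\pi i x}$. Let $$B=\begin{pmatrix} w\,e(\phi) & -\sqrt{1-w^2}\,e(\theta-\psi)\\ \sqrt{1-w^2}\,e(\psi) & w\,e(\theta-\phi)\end{pmatrix}\in U(2),\qquad 0<w\le 1,\quad \theta,\phi,\psi\in\mathbb R .$$ Let $P_B=\frac{1}{2\pi i}\frac{d}{dx}$ in $L^2(\Omega)$, with domain the set of those $f\in L^2(\Omega)$ that are absolutely continuous on the compact subintervals of $\Omega$, with $f'\in L^2(\Omega)$, and whose one-sided boundary values satisfy $B\binom{f(1)}{f(\beta)}=\binom{f(0)}{f(\alpha)}$. A function $\Psi$ that is bounded on $\Omega$, Borel measurable and not a.e. zero on $\Omega$ is called a bounded generalized eigenfunction of $P_B$ for $\lambda\in\mathbb R$ if $$\int_\Omega \tfrac{1}{2\pi i}\eta'\,\overline{\Psi}\,dx=\lambda\int_\Omega\eta\,\overline{\Psi}\,dx$$ for all $\eta\in C_c^\infty(\mathbb R)$ that, together with all their derivatives, satisfy the same boundary condition. **Theorem 2.1.**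 There are functions $\psi^{(B)}_\lambda$ ($\lambda\in\mathbb R$), jointly measurable in $(\lambda,x)$ and bounded on $\Omega$ uniformly in $\lambda$, and a positive Borel function $F_B$ on $\mathbb R$ such that the following hold. 1. For every $\lambda\in\mathbb R$, $\psi^{(B)}_\lambda$ is a bounded generalized eigenfunction of $P_B$ for $\lambda$, normalized by $\psi_\lambda^{(B)}(x)=e(\lambda x)$ for $1<x<\alpha$. 2. $P_B$ generates a strongly continuous unitary one-parameter group $U_B(t)=e^{-2\pi i tP_B}$ on $L^2(\Omega)$ (that is, $f$ is in the domain of $P_B$ and $P_Bf=g$ if and only if $t\mapsto U_B(t)f$ has derivative $-2\pi i g$ at $t=0$), and for every $f\in L^2(\Omega)$ and $t\in\mathbb R$ $$(U_B(t)f)(x)=\int_{\mathbb R}e(-\lambda t)\,\langle\psi_\lambda^{(B)},f\rangle_\Omega\,\psi_\lambda^{(B)}(x)\,F_B(\lambda)\,d\lambda,\qquad \langle\psi_\lambda^{(B)},f\rangle_\Omega=\int_\Omega\overline{\psi_\lambda^{(B)}(y)}\,f(y)\,dy .$$ Both integrals are limits in the mean, as for the $L^2$ Fourier transform: $\langle\psi^{(B)}_\lambda,f\rangle_\Omega$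 is the limit in $L^2(\mathbb R,F_B(\lambda)d\lambda)$ of the integrals over $\Omega\cap[-R,R]$ as $R\to\infty$, and $U_B(t)f$ is the limit in $L^2(\Omega)$ of the integrals over $|\lambda|\le R$ as $R\to\infty$. 3. $F_B$ is periodic with period $(\alpha-1)^{-1}$, and on each period it is the Poisson kernel of the unit disc with pole parameter $r\,e(\psi)$, where $r=\sqrt{1-w^2}$, at the boundary point $e((\alpha-1)\lambda)$: $$F_B(\lambda)=\frac{1-r^2}{|e((\alpha-1)\lambda)-r\,e(\psi)|^2}=\frac{1-r^2}{1-2r\cos\big(2\pi((\alpha-1)\lambda-\psi)\big)+r^2}.$$ 4. There are no bound states: $P_B$ has no nonzero eigenvector in $L^2(\Omega)$. -/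

import Mathlib

open MeasureTheory Filter Topology Set

open scoped ENNReal Matrix ComplexConjugate InnerProductSpace

noncomputable section

namespace ExteriorMomentum

/-- The character `e(x) = exp(2πix)`. -/
def e (x : ℝ) : ℂ := Complex.exp (2 * Real.pi * Complex.I * x)

/-- The exterior domain `Ω = (-∞, 0) ∪ (1, α) ∪ (β, ∞)`. -/
def Omega (α β : ℝ) : Set ℝ := Iio 0 ∪ Ioo 1 α ∪ Ioi β

/-- The Hilbert space `L²(Ω)` of complex valued functions, for Lebesgue measure. -/
abbrev L2 (α β : ℝ) : Type := Lp ℂ 2 (volume.restrict (Omega α β))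

/-- The parametrization of the unitary `2 × 2` matrices, with `0 ≤ w ≤ 1` and `θ, φ, ψ` real. -/
def boundaryMatrix (w θ φ ψ : ℝ) : Matrix (Fin 2) (Fin 2) ℂ :=
  !![(w : ℂ) * e φ, -((Real.sqrt (1 - w ^ 2) : ℝ) : ℂ) * e (θ - ψ);
     ((Real.sqrt (1 - w ^ 2) : ℝ) : ℂ) * e ψ, (w : ℂ) * e (θ - φ)]

/-- `F` is absolutely continuous on every compact interval contained in `Ω`. -/
def IsACOn (α β : ℝ) (F : ℝ → ℂ) : Prop :=
  ∀ a b : ℝ, a ≤ b → Icc a b ⊆ Omega α β → AbsolutelyContinuousOnInterval F a b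

/-- The boundary condition `B (F(1), F(β))ᵀ = (F(0), F(α))ᵀ`, the boundary values being the
one-sided limits taken from within `Ω`. -/
def BoundaryCondition (α β : ℝ) (B : Matrix (Fin 2) (Fin 2) ℂ) (F : ℝ → ℂ) : Prop :=
  ∃ v₀ v₁ vα vβ : ℂ,
    Tendsto F (𝓝[<] 0) (𝓝 v₀) ∧ Tendsto F (𝓝[>] 1) (𝓝 v₁) ∧
    Tendsto F (𝓝[<] α) (𝓝 vα) ∧ Tendsto F (𝓝[>] β) (𝓝 vβ) ∧
    B *ᵥ ![v₁, vβ] = ![v₀, vα]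

/-- `f` lies in the domain of `P_B` and `P_B f = g`: the class `f ∈ L²(Ω)` has an absolutely
continuous representative `F` satisfying the boundary condition, and
`g = (2πi)⁻¹ F'` belongs to `L²(Ω)`. -/
def IsMomentum (α β : ℝ) (B : Matrix (Fin 2) (Fin 2) ℂ) (f g : L2 α β) : Prop :=
  ∃ F : ℝ → ℂ, IsACOn α β F ∧ BoundaryCondition α β B F ∧
    f =ᵐ[volume.restrict (Omega α β)] F ∧
    g =ᵐ[volume.restrict (Omega α β)] fun x => (2 * Real.pi * Complex.I)⁻¹ * deriv F x

theorem isOpen_Omega (α β : ℝ) : IsOpen (Omega α β) :=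
  (isOpen_Iio.union isOpen_Ioo).union isOpen_Ioi

theorem exists_rat_Icc_subset {α β x : ℝ} (hx : x ∈ Omega α β) :
    ∃ p : ℚ × ℚ, (p.1 : ℝ) < x ∧ x < p.2 ∧ Icc (p.1 : ℝ) p.2 ⊆ Omega α β := by
  obtain ⟨ε, hε, h⟩ := Metric.isOpen_iff.1 (isOpen_Omega α β) x hx
  obtain ⟨a, ha1, ha2⟩ := exists_rat_btwn (show x - ε < x by linarith)
  obtain ⟨b, hb1, hb2⟩ := exists_rat_btwn (show x < x + ε by linarith)
  refine ⟨(a, b), ha2, hb1, fun y hy => h ?_⟩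
  rw [Metric.mem_ball, Real.dist_eq, abs_lt]
  constructor <;> linarith [hy.1, hy.2]

theorem ac_comp_lipschitz {F : ℝ → ℂ} {a b : ℝ} (hF : AbsolutelyContinuousOnInterval F a b)
    (L : ℂ → ℝ) (hL : ∀ z w, dist (L z) (L w) ≤ dist z w) :
    AbsolutelyContinuousOnInterval (fun x => L (F x)) a b := by
  rw [absolutelyContinuousOnInterval_iff] at hF ⊢
  intro ε hε
  obtain ⟨δ, hδ, h⟩ := hF ε hε
  refine ⟨δ, hδ, fun E hE hE' => lt_of_le_of_lt ?_ (h E hE hE')⟩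
  exact Finset.sum_le_sum fun i _ => hL _ _

theorem IsACOn.ae_differentiableAt {α β : ℝ} {F : ℝ → ℂ} (hF : IsACOn α β F) :
    ∀ᵐ x ∂(volume.restrict (Omega α β)), DifferentiableAt ℝ F x := by
  rw [ae_restrict_iff' (isOpen_Omega α β).measurableSet]
  have key : ∀ p : ℚ × ℚ, ∀ᵐ x : ℝ, (p.1 : ℝ) ≤ p.2 → Icc (p.1 : ℝ) p.2 ⊆ Omega α β →
      x ∈ Icc (p.1 : ℝ) p.2 → DifferentiableAt ℝ F x := by
    intro p
    by_cases hp : (p.1 : ℝ) ≤ p.2 ∧ Icc (p.1 : ℝ) p.2 ⊆ Omega α β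
    · have h := hF _ _ hp.1 hp.2
      have h1 := (ac_comp_lipschitz h Complex.re fun z w => by
        rw [Real.dist_eq, Complex.dist_eq, ← Complex.sub_re]
        exact Complex.abs_re_le_norm _).ae_differentiableAt
      have h2 := (ac_comp_lipschitz h Complex.im fun z w => by
        rw [Real.dist_eq, Complex.dist_eq, ← Complex.sub_im]
        exact Complex.abs_im_le_norm _).ae_differentiableAt
      filter_upwards [h1, h2] with x hx1 hx2 _ _ hx
      rw [uIcc_of_le hp.1] at hx1 hx2
      have hr := (hx1 hx).hasDerivAt.ofReal_comp
      have hi := (hx2 hx).hasDerivAt.ofReal_comp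
      have h3 := (hr.add (hi.mul_const Complex.I)).differentiableAt
      refine h3.congr_of_eventuallyEq (Eventually.of_forall fun y => ?_)
      simp [Complex.re_add_im]
    · exact Eventually.of_forall fun x h1 h2 => absurd ⟨h1, h2⟩ hp
  filter_upwards [ae_all_iff.2 key] with x hx hxO
  obtain ⟨p, h1, h2, h3⟩ := exists_rat_Icc_subset hxO
  exact hx p (h1.trans h2).le h3 ⟨h1.le, h2.le⟩

theorem IsACOn.continuousOn {α β : ℝ} {F : ℝ → ℂ} (hF : IsACOn α β F) :
    ContinuousOn F (Omega α β) := by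
  intro x hx
  obtain ⟨p, h1, h2, h3⟩ := exists_rat_Icc_subset hx
  have h := (hF _ _ (h1.trans h2).le h3).continuousOn
  rw [uIcc_of_le (h1.trans h2).le] at h
  exact (h.continuousAt (Icc_mem_nhds h1 h2)).continuousWithinAt

/-- The graph of `P_B`, as a subspace of `L²(Ω) × L²(Ω)`. -/
def momentumGraph (α β : ℝ) (B : Matrix (Fin 2) (Fin 2) ℂ) :
    Submodule ℂ (L2 α β × L2 α β) where
  carrier := {p | IsMomentum α β B p.1 p.2}
  zero_mem' := by
    refine ⟨fun _ => 0, fun a b _ _ => ?_, ⟨0, 0, 0, 0, tendsto_const_nhds, tendsto_const_nhds,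
      tendsto_const_nhds, tendsto_const_nhds, ?_⟩, Lp.coeFn_zero _ _ _, ?_⟩
    · rw [absolutelyContinuousOnInterval_iff]
      exact fun ε hε => ⟨1, one_pos, fun E _ _ => by simpa using hε⟩
    · ext i; fin_cases i <;> simp [Matrix.mulVec, dotProduct]
    · filter_upwards [Lp.coeFn_zero ℂ 2 (volume.restrict (Omega α β))] with x hx
      simpa using hx
  add_mem' := by
    rintro ⟨f, g⟩ ⟨f', g'⟩ ⟨F, hF, ⟨v₀, v₁, vα, vβ, h0, h1, ha, hb, hB⟩, hf, hg⟩
      ⟨F', hF', ⟨v₀', v₁', vα', vβ', h0', h1', ha', hb', hB'⟩, hf', hg'⟩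
    refine ⟨F + F', fun a b hab h => (hF a b hab h).add (hF' a b hab h),
      ⟨v₀ + v₀', v₁ + v₁', vα + vα', vβ + vβ', h0.add h0', h1.add h1', ha.add ha', hb.add hb', ?_⟩,
      ?_, ?_⟩
    · have e1 : ![v₁ + v₁', vβ + vβ'] = ![v₁, vβ] + ![v₁', vβ'] := by simp
      rw [e1, Matrix.mulVec_add, hB, hB']; simp
    · filter_upwards [Lp.coeFn_add f f', hf, hf'] with x h h1 h2
      simp only [Prod.mk_add_mk] at *
      rw [h, Pi.add_apply, h1, h2, Pi.add_apply]
    · filter_upwards [Lp.coeFn_add g g', hg, hg', hF.ae_differentiableAt,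
        hF'.ae_differentiableAt] with x h h1 h2 d1 d2
      simp only [Prod.mk_add_mk] at *
      rw [h, Pi.add_apply, h1, h2, deriv_add d1 d2, mul_add]
  smul_mem' := by
    rintro c ⟨f, g⟩ ⟨F, hF, ⟨v₀, v₁, vα, vβ, h0, h1, ha, hb, hB⟩, hf, hg⟩
    refine ⟨c • F, fun a b hab h => (hF a b hab h).const_smul c,
      ⟨c • v₀, c • v₁, c • vα, c • vβ, h0.const_smul c, h1.const_smul c, ha.const_smul c,
        hb.const_smul c, ?_⟩, ?_, ?_⟩
    · have e1 : ![c • v₁, c • vβ] = c • ![v₁, vβ] := by simp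
      rw [e1, Matrix.mulVec_smul, hB]; simp
    · filter_upwards [Lp.coeFn_smul c f, hf] with x h h1
      simp only [Prod.smul_mk] at *
      rw [h, Pi.smul_apply, h1, Pi.smul_apply]
    · filter_upwards [Lp.coeFn_smul c g, hg, hF.ae_differentiableAt] with x h h1 d1
      simp only [Prod.smul_mk] at *
      rw [h, Pi.smul_apply, h1, deriv_const_smul c d1]
      simp only [smul_eq_mul]; ring

/-- The momentum operator `P_B = (2πi)⁻¹ d/dx` in `L²(Ω)` with the boundary condition given
by `B`, as a partially defined linear operator. -/
def momentumOp (α β : ℝ) (B : Matrix (Fin 2) (Fin 2) ℂ) : L2 α β →ₗ.[ℂ] L2 α β :=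
  (momentumGraph α β B).toLinearPMap

/-- The graph of `momentumOp` is the intended one. -/
theorem mem_graph_momentumOp (α β : ℝ) (B : Matrix (Fin 2) (Fin 2) ℂ) (f g : L2 α β) :
    (f, g) ∈ (momentumOp α β B).graph ↔ IsMomentum α β B f g := by
  unfold momentumOp
  rw [Submodule.toLinearPMap_graph_eq]
  · rfl
  · rintro ⟨f, g⟩ ⟨F, hF, -, hf, hg⟩ (rfl : f = 0)
    have hF0 : F =ᵐ[volume.restrict (Omega α β)] fun _ => (0 : ℂ) := by
      filter_upwards [hf, Lp.coeFn_zero ℂ 2 (volume.restrict (Omega α β))] with x h1 h2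
      rw [← h1, h2]; rfl
    have hE : EqOn F (fun _ => 0) (Omega α β) :=
      MeasureTheory.Measure.eqOn_open_of_ae_eq hF0 (isOpen_Omega α β) hF.continuousOn
        continuousOn_const
    refine Lp.ext ?_
    filter_upwards [hg, Lp.coeFn_zero ℂ 2 (volume.restrict (Omega α β)),
      ae_restrict_mem (isOpen_Omega α β).measurableSet] with x h1 h2 h3
    have h4 : F =ᶠ[𝓝 x] fun _ => 0 := hE.eventuallyEq_of_mem ((isOpen_Omega α β).mem_nhds h3)
    rw [h1, h2, h4.deriv_eq]
    simp

/-- A strongly continuous one-parameter group of unitary operators. -/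
structure UnitaryGroup (H : Type*) [NormedAddCommGroup H] [InnerProductSpace ℂ H] where
  /-- the unitary operator at time `t` -/
  op : ℝ → H ≃ₗᵢ[ℂ] H
  op_zero : ∀ f, op 0 f = f
  op_add : ∀ s t f, op (s + t) f = op s (op t f)
  continuous_op : ∀ f, Continuous fun t => op t f

/-- `U` is the unitary one-parameter group generated by `A`, i.e. `U(t) = exp(-2πitA)`: the domain
of `A` consists of those `f` for which `t ↦ U(t) f` is differentiable at `0`, and the derivative
is then `-2πi A f`. -/
def UnitaryGroup.IsGeneratedBy {H : Type*} [NormedAddCommGroup H] [InnerProductSpace ℂ H]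
    (U : UnitaryGroup H) (A : H →ₗ.[ℂ] H) : Prop :=
  ∀ f g : H, (f, g) ∈ A.graph ↔
    HasDerivAt (fun t : ℝ => U.op t f) (-(2 * Real.pi * Complex.I) • g) 0

/-- The test functions: smooth compactly supported functions on the line which, together with
all their derivatives, satisfy the boundary condition. (Only their restrictions to `Ω` matter.) -/
def IsTestFunction (α β : ℝ) (B : Matrix (Fin 2) (Fin 2) ℂ) (η : ℝ → ℂ) : Prop :=
  ContDiff ℝ (⊤ : ℕ∞) η ∧ HasCompactSupport η ∧
    ∀ k : ℕ, B *ᵥ ![iteratedDeriv k η 1, iteratedDeriv k η β] =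
      ![iteratedDeriv k η 0, iteratedDeriv k η α]

/-- The bounded function `Ψ` is a generalized eigenfunction of `P_B` for the generalized
eigenvalue `l`: it is not zero as a distribution on `Ω`, and `⟨Pη, Ψ⟩ = l ⟨η, Ψ⟩` for all test
functions `η`, where `⟨η, Ψ⟩` is the integral of `η` times the conjugate of `Ψ` over `Ω`. -/
def IsBoundedGeneralizedEigenfunction (α β : ℝ) (B : Matrix (Fin 2) (Fin 2) ℂ) (l : ℝ)
    (Ψ : ℝ → ℂ) : Prop :=
  Measurable Ψ ∧ (∃ C : ℝ, ∀ x ∈ Omega α β, ‖Ψ x‖ ≤ C) ∧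
  ¬ (∀ᵐ x ∂(volume.restrict (Omega α β)), Ψ x = 0) ∧
  ∀ η : ℝ → ℂ, IsTestFunction α β B η →
    ∫ x in Omega α β, ((2 * Real.pi * Complex.I)⁻¹ * deriv η x) * conj (Ψ x) =
      (l : ℂ) * ∫ x in Omega α β, η x * conj (Ψ x)

/-- The truncated transform: the integral of `conj Ψ_l · f` over `Ω ∩ [-R, R]`, as a
function of `l`. -/
def truncTransform (α β : ℝ) (Ψ : ℝ → ℝ → ℂ) (f : ℝ → ℂ) (R : ℝ) (l : ℝ) : ℂ :=
  ∫ x in Omega α β ∩ Icc (-R) R, conj (Ψ l x) * f x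

/-- The truncated expansion: the integral over `l ∈ [-R, R]` of
`e(-lt) g(l) Ψ_l(x) F(l)`, as a function of `x`. -/
def truncExpansion (Ψ : ℝ → ℝ → ℂ) (F : ℝ → ℝ) (g : ℝ → ℂ) (t R : ℝ) (x : ℝ) : ℂ :=
  ∫ l in Icc (-R) R, e (-(l * t)) * g l * Ψ l x * (F l : ℂ)

/-- The measure `F(l) dl` on the line. -/
def spectralMeasure (F : ℝ → ℝ) : Measure ℝ := volume.withDensity fun l => ENNReal.ofReal (F l)

/-- The eigenfunction expansion
`(U(t) f)(x) = ∫ e(-lt) ⟨Ψ_l, f⟩ Ψ_l(x) F(l) dl`  for all `f ∈ L²(Ω)` and all real `t`.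
As for the Fourier transform of square integrable functions, both integrals are
limits in the mean: `g(l) = ⟨Ψ_l, f⟩` is the limit in `L²(F(l) dl)` of the integrals over
`Ω ∩ [-R, R]`, and `U(t) f` is the limit in `L²(Ω)` of the integrals over `|l| ≤ R`. -/
def HasEigenfunctionExpansion (α β : ℝ) (U : UnitaryGroup (L2 α β)) (Ψ : ℝ → ℝ → ℂ)
    (F : ℝ → ℝ) : Prop :=
  ∀ f : L2 α β, ∃ g : ℝ → ℂ, MemLp g 2 (spectralMeasure F) ∧
    Tendsto (fun R : ℝ => eLpNorm (fun l => truncTransform α β Ψ f R l - g l) 2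
      (spectralMeasure F)) atTop (𝓝 0) ∧
    ∀ t : ℝ, Tendsto (fun R : ℝ => eLpNorm (fun x => truncExpansion Ψ F g t R x - U.op t f x) 2
      (volume.restrict (Omega α β))) atTop (𝓝 0)

end ExteriorMomentum

end

/-!
Solving the boundary condition for the values at `0` and `β` gives
`f(0) = p (f(1) - c̄ f(α))` and `f(β) = q (f(α) - c f(1))` with `c = √(1 - w²) e(ψ)`, `|c| < 1` and
`|p|² = |q|² = 1 / (1 - |c|²)`. So from a function `u` on the whole line one obtains a function on
`Ω` that satisfies the boundary condition: keep `u` on `(1, α)`, and take the prescribed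
combinations of two translates of `u` on `(-∞, 0)` and `(β, ∞)` (`Coupling.sew`). Sewing has four
properties, from which everything follows.

* It turns the translations of the line into the motion generated by `P_B`.
* `‖sew u‖ = ‖q (u(· + α) - c u(· + 1))‖`, where the right-hand norm is that of `L²(ℝ)`
  (`Coupling.norm_sewLp`). The right-hand side is invariant under translations, so the motion is
  unitary, and in Fourier space it is multiplication by a symbol whose inverse square modulus is
  the Poisson kernel `F_B`.
* It is a bijection of `L²(ℝ)` onto `L²(Ω)` (`Coupling.sewEquiv`): outside of `(1, α)` a preimage is
  determined recursively, with the contraction factor `|c|`.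
* It maps the plane wave `e(lx)` to the generalized eigenfunction `ψ_l`.

Hence the expansion in the `ψ_l` is the sewn Fourier inversion formula. The coefficient
`⟨ψ_l, f⟩` is the Fourier transform of the preimage of `f`, divided by `F_B`
(`Coupling.transform_ae_eq`): pair both with sewn wave packets, and use Plancherel's theorem and
the norm identity.

The generator of the sewn translation group is contained in `P_B`, since a differentiable orbit of
translations in `L²(ℝ)` comes from an absolutely continuous function
(`ae_eq_integral_of_hasDerivAt_translate`). It is all of `P_B`, because `P_B` has no eigenvectors,
for complex eigenvalues either (`Coupling.eq_zero_of_isMomentum_smul`). Finally, an operator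
generates at most one unitary group (`UnitaryGroup.op_eq_of_isGeneratedBy`).
-/

noncomputable section

namespace ExteriorMomentum

/-! ### One-parameter unitary groups and their generators -/

/-- By the contraction principle, `1 - T` is onto when `T` is a strict contraction. -/
theorem exists_sub_map_eq {E : Type*} [NormedAddCommGroup E] [NormedSpace ℂ E] [CompleteSpace E]
    (T : E →ₗ[ℂ] E) {r : ℝ} (hr0 : 0 ≤ r) (hr : r < 1) (hT : ∀ x, ‖T x‖ ≤ r * ‖x‖) (b : E) :
    ∃ x, x = T x + b := by
  have hc : ContractingWith ⟨r, hr0⟩ (fun x => T x + b) := by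
    refine ⟨by exact_mod_cast hr, LipschitzWith.of_dist_le_mul fun x y => ?_⟩
    rw [dist_add_right, dist_eq_norm, dist_eq_norm, ← map_sub]
    exact hT _
  exact ⟨_, hc.fixedPoint_isFixedPt.symm⟩

section UnitaryGroup

variable {H : Type*} [NormedAddCommGroup H] [InnerProductSpace ℂ H]

theorem UnitaryGroup.hasDerivAt_op (U : UnitaryGroup H) {f g : H}
    (h : HasDerivAt (fun t : ℝ => U.op t f) g 0) (t : ℝ) :
    HasDerivAt (fun s : ℝ => U.op s f) (U.op t g) t := by
  have h1 : HasDerivAt (fun s : ℝ => U.op (s - t) f) g t := by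
    have h2 : HasDerivAt (fun s : ℝ => U.op s f) g (t - t) := by rwa [sub_self]
    exact h2.comp_sub_const t t
  have h3 := ((U.op t).toContinuousLinearEquiv : H →L[ℂ] H).hasFDerivAt.restrictScalars ℝ
    |>.comp_hasDerivAt t h1
  refine h3.congr_of_eventuallyEq (Eventually.of_forall fun s => ?_)
  change U.op s f = U.op t (U.op (s - t) f)
  rw [← U.op_add, add_sub_cancel]

/-- The orbit of a vector in the domain of the generator stays in the domain, and the generator
commutes with the group. -/
theorem UnitaryGroup.hasDerivAt_op_zero (U : UnitaryGroup H) {f g : H}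
    (h : HasDerivAt (fun t : ℝ => U.op t f) g 0) (s : ℝ) :
    HasDerivAt (fun t : ℝ => U.op t (U.op s f)) (U.op s g) 0 := by
  have h1 : HasDerivAt (fun t : ℝ => U.op (t + s) f) (U.op s g) 0 := by
    have h2 : HasDerivAt (fun t : ℝ => U.op t f) (U.op s g) (0 + s) := by
      rw [zero_add]; exact U.hasDerivAt_op h s
    exact h2.comp_add_const 0 s
  exact h1.congr_of_eventuallyEq (Eventually.of_forall fun t => (U.op_add t s f).symm)

/-- The generator of a unitary group is skew-symmetric. -/
theorem UnitaryGroup.re_inner_eq_zero (U : UnitaryGroup H) {f g : H}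
    (h : HasDerivAt (fun t : ℝ => U.op t f) g 0) : (inner ℂ f g).re = 0 := by
  have h1 := h.inner ℂ h
  have h2 : (fun t : ℝ => inner ℂ (U.op t f) (U.op t f)) = fun _ => inner ℂ f f := by
    ext t; exact (U.op t).inner_map_map f f
  rw [h2] at h1
  have h3 := h1.unique (hasDerivAt_const 0 (inner ℂ f f))
  rw [U.op_zero, ← inner_conj_symm g f] at h3
  have h4 := congrArg Complex.re h3
  simp only [Complex.add_re, Complex.conj_re, Complex.zero_re] at h4
  linarith

variable [CompleteSpace H]

/-- Exponentially weighted averages along an orbit lie in the domain of the generator. -/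
theorem UnitaryGroup.hasDerivAt_average (U : UnitaryGroup H) (κ : ℂ) (a : ℝ) (v : H) :
    HasDerivAt (fun t : ℝ => U.op t (∫ s in (0 : ℝ)..a, Complex.exp (κ * s) • U.op s v))
      (Complex.exp (κ * a) • U.op a v - v
        - κ • ∫ s in (0 : ℝ)..a, Complex.exp (κ * s) • U.op s v) 0 := by
  set φ : ℝ → H := fun s => Complex.exp (κ * s) • U.op s v with hφ
  have hc : Continuous φ := by
    have := U.continuous_op v
    fun_prop
  have key : ∀ t : ℝ, U.op t (∫ s in (0 : ℝ)..a, φ s) =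
      Complex.exp (-κ * t) • ∫ s in t..(a + t), φ s := by
    intro t
    have h1 := ((U.op t).toContinuousLinearEquiv : H →L[ℂ] H).intervalIntegral_comp_comm
      (hc.intervalIntegrable (μ := volume) 0 a)
    have h2 : (∫ s in t..(a + t), φ s) = ∫ s in (0 : ℝ)..a, φ (s + t) := by
      rw [intervalIntegral.integral_comp_add_right, zero_add]
    rw [h2, ← intervalIntegral.integral_smul]
    refine h1.symm.trans (intervalIntegral.integral_congr fun s _ => ?_)
    change U.op t (φ s) = _
    simp only [hφ, map_smul, smul_smul]
    rw [← Complex.exp_add, ← U.op_add, add_comm t s]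
    congr 2
    push_cast; ring
  have hd : HasDerivAt (fun t : ℝ => ∫ s in t..(a + t), φ s) (φ a - φ 0) 0 := by
    have e1 : (fun t : ℝ => ∫ s in t..(a + t), φ s) =
        fun t : ℝ => (∫ s in (0 : ℝ)..(a + t), φ s) - ∫ s in (0 : ℝ)..t, φ s := by
      ext t
      rw [intervalIntegral.integral_interval_sub_left] <;> exact hc.intervalIntegrable _ _
    rw [e1]
    have e2 : HasDerivAt (fun t : ℝ => ∫ s in (0 : ℝ)..t, φ s) (φ a) (a + 0) := by
      rw [add_zero]
      exact intervalIntegral.integral_hasDerivAt_right (hc.intervalIntegrable _ _)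
        (hc.stronglyMeasurableAtFilter _ _) hc.continuousAt
    exact (e2.comp_const_add a 0).sub (intervalIntegral.integral_hasDerivAt_right
      (hc.intervalIntegrable _ _) (hc.stronglyMeasurableAtFilter _ _) hc.continuousAt)
  have he : HasDerivAt (fun t : ℝ => Complex.exp (-κ * t)) (-κ) 0 := by
    have h0 : HasDerivAt (fun t : ℝ => -κ * (t : ℂ)) (-κ * 1) 0 :=
      (Complex.ofRealCLM.hasDerivAt (x := (0 : ℝ))).const_mul (-κ)
    simpa using h0.cexp
  have h3 := he.smul hd
  refine (h3.congr_of_eventuallyEq (Eventually.of_forall key)).congr_deriv ?_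
  simp only [hφ, U.op_zero, Complex.ofReal_zero, mul_zero, Complex.exp_zero, one_smul, add_zero]
  module

/-- With `D` the derivative of the group at `0`, the operator `1 - D` is onto. -/
theorem UnitaryGroup.exists_hasDerivAt_sub (U : UnitaryGroup H) (y : H) :
    ∃ x, HasDerivAt (fun t : ℝ => U.op t x) (x - y) 0 := by
  -- The average of the orbit of `v` over `[0, 1]` with weight `exp(-s)` has derivative
  -- `x - (v - exp(-1) U(1) v)`, and `1 - exp(-1) U(1)` is onto.
  obtain ⟨v, hv⟩ := exists_sub_map_eq
    (Complex.exp (-1) • ((U.op 1).toLinearEquiv : H →ₗ[ℂ] H)) (r := Real.exp (-1))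
    (Real.exp_pos _).le (by rw [Real.exp_lt_one_iff]; norm_num) (fun x => by
      simp [norm_smul, Complex.norm_exp]) y
  refine ⟨_, (U.hasDerivAt_average (-1) 1 v).congr_deriv ?_⟩
  have hv' : Complex.exp (-1) • U.op 1 v = v - y := by
    rw [eq_sub_iff_add_eq]; exact hv.symm
  simp only [Complex.ofReal_one, mul_one, hv']
  module

/-- The domain of the generator is dense: averages over short times lie in it. -/
theorem UnitaryGroup.dense_domain (U : UnitaryGroup H) :
    Dense {f : H | ∃ g, HasDerivAt (fun t : ℝ => U.op t f) g 0} := by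
  intro f
  have hd : HasDerivAt (fun t : ℝ => ∫ s in (0 : ℝ)..t, U.op s f) f 0 := by
    have := intervalIntegral.integral_hasDerivAt_right
      ((U.continuous_op f).intervalIntegrable (μ := volume) 0 0)
      ((U.continuous_op f).stronglyMeasurableAtFilter _ _) (U.continuous_op f).continuousAt
    rwa [U.op_zero] at this
  have h1 := hd.tendsto_slope_zero_right
  refine mem_closure_of_tendsto h1 (Eventually.of_forall fun t => ?_)
  have h2 := U.hasDerivAt_average 0 t f
  simp only [zero_mul, Complex.exp_zero, one_smul, zero_smul, sub_zero] at h2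
  refine ⟨t⁻¹ • (U.op t f - f), ?_⟩
  have h3 := h2.const_smul (t⁻¹ : ℂ)
  refine (h3.congr_of_eventuallyEq (Eventually.of_forall fun s => ?_)).congr_deriv ?_
  · simp [← Complex.coe_smul]
  · simp [← Complex.coe_smul]

/-- A partially defined operator generates at most one unitary group: the difference of two orbits
of a vector in the domain has constant norm, since the generator is skew-symmetric. -/
theorem UnitaryGroup.op_eq_of_isGeneratedBy {U V : UnitaryGroup H} {A : H →ₗ.[ℂ] H}
    (hU : U.IsGeneratedBy A) (hV : V.IsGeneratedBy A) (t : ℝ) (f : H) : U.op t f = V.op t f := by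
  have hUV : ∀ f g : H, HasDerivAt (fun t : ℝ => U.op t f) g 0 ↔
      HasDerivAt (fun t : ℝ => V.op t f) g 0 := by
    intro f g
    have h2 : -(2 * Real.pi * Complex.I) ≠ 0 := neg_ne_zero.2 Complex.two_pi_I_ne_zero
    have e1 : g = -(2 * Real.pi * Complex.I) • ((-(2 * Real.pi * Complex.I))⁻¹ • g) := by
      rw [smul_smul, mul_inv_cancel₀ h2, one_smul]
    rw [e1, ← hU, ← hV]
  have hcl : IsClosed {f : H | U.op t f = V.op t f} :=
    isClosed_eq (U.op t).continuous (V.op t).continuous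
  refine hcl.closure_subset_iff.2 ?_ (U.dense_domain f)
  rintro f ⟨g, hg⟩
  have hg' := (hUV f g).1 hg
  set x : ℝ → H := fun s => U.op s f - V.op s f with hx
  have hx' : ∀ s, HasDerivAt x (U.op s g - V.op s g) s := fun s =>
    (U.hasDerivAt_op hg s).sub (V.hasDerivAt_op hg' s)
  have hre : ∀ s, (inner ℂ (x s) (U.op s g - V.op s g)).re = 0 := by
    intro s
    apply U.re_inner_eq_zero
    have h1 := (U.hasDerivAt_op_zero hg s).sub ((hUV _ _).2 (V.hasDerivAt_op_zero hg' s))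
    refine h1.congr_of_eventuallyEq (Eventually.of_forall fun r => ?_)
    simp [hx]
  have hn : ∀ s, HasDerivAt (fun s => (inner ℂ (x s) (x s)).re) 0 s := by
    intro s
    have h1 := ((hx' s).inner ℂ (hx' s))
    have h2 := Complex.reCLM.hasFDerivAt.comp_hasDerivAt s h1
    refine h2.congr_deriv ?_
    rw [← inner_conj_symm (U.op s g - V.op s g), Complex.reCLM_apply, Complex.add_re,
      Complex.conj_re, hre s, add_zero]
  have hconst := is_const_of_deriv_eq_zero (fun s => (hn s).differentiableAt)
    (fun s => (hn s).deriv) t 0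
  have h0 : x 0 = 0 := by simp [hx, U.op_zero, V.op_zero]
  simp only [h0, inner_zero_left, Complex.zero_re] at hconst
  have h4 : x t = 0 := by
    rw [← norm_eq_zero, ← sq_eq_zero_iff, ← inner_self_eq_norm_sq (𝕜 := ℂ)]
    exact hconst
  exact sub_eq_zero.1 h4

end UnitaryGroup

/-! ### Translations of `L²(ℝ)` -/

/-- The Hilbert space `L²(ℝ)`. -/
abbrev L2R : Type := Lp ℂ 2 (volume : Measure ℝ)

/-- The translation `u ↦ u(· + a)` of `L²(ℝ)`. -/
def translate (a : ℝ) : L2R →ₗᵢ[ℂ] L2R :=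
  Lp.compMeasurePreservingₗᵢ ℂ (fun x => x + a) (measurePreserving_add_right volume a)

theorem coeFn_translate (a : ℝ) (u : L2R) : translate a u =ᵐ[volume] fun x => u (x + a) :=
  Lp.coeFn_compMeasurePreserving u (measurePreserving_add_right volume a)

theorem ae_comp_add_right {p : ℝ → Prop} (h : ∀ᵐ x, p x) (a : ℝ) : ∀ᵐ x, p (x + a) :=
  (measurePreserving_add_right volume a).quasiMeasurePreserving.ae h

theorem translate_zero (u : L2R) : translate 0 u = u := by
  refine Lp.ext ?_
  filter_upwards [coeFn_translate 0 u] with x hx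
  rw [hx, add_zero]

theorem translate_translate (a b : ℝ) (u : L2R) :
    translate a (translate b u) = translate (a + b) u := by
  refine Lp.ext ?_
  filter_upwards [coeFn_translate a (translate b u), coeFn_translate (a + b) u,
    ae_comp_add_right (coeFn_translate b u) a] with x h1 h2 h3
  rw [h1, h2, h3, add_assoc]

theorem continuous_translate (u : L2R) : Continuous fun a => translate a u := by
  let f : ℝ → C(ℝ, ℝ) := fun a => ⟨fun x => x + a, by fun_prop⟩
  have hf : Continuous f := ContinuousMap.continuous_of_continuous_uncurry _
    (show Continuous fun p : ℝ × ℝ => p.2 + p.1 by fun_prop)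
  have hm : ∀ a, MeasurePreserving (f a) volume volume := fun a =>
    measurePreserving_add_right volume a
  exact Continuous.compMeasurePreservingLp (p := 2) (f := fun _ : ℝ => u) continuous_const hf
    hm ENNReal.ofNat_ne_top

theorem L2R.intervalIntegrable (u : L2R) (a b : ℝ) : IntervalIntegrable u volume a b :=
  (((Lp.memLp u).locallyIntegrable (by norm_num)).integrableOn_isCompact
    isCompact_uIcc).intervalIntegrable

/-- If the translates of `u` are differentiable in `L²(ℝ)`, then `u` is an indefinite integral of
the derivative `v`: integrate the difference quotients over `[a, b]`, where `a` and `b` are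
Lebesgue points of `u`. -/
theorem ae_eq_integral_of_hasDerivAt_translate {u v : L2R}
    (h : HasDerivAt (fun t : ℝ => translate t u) v 0) :
    ∃ (c : ℂ) (a : ℝ), ∀ᵐ x, u x = c + ∫ y in a..x, v y := by
  have hL := LocallyIntegrable.ae_hasDerivAt_integral
    ((Lp.memLp u).locallyIntegrable (by norm_num) : LocallyIntegrable u volume)
  have key : ∀ a b : ℝ, a ≤ b → HasDerivAt (fun x => ∫ y in (0 : ℝ)..x, u y) (u a) a →
      HasDerivAt (fun x => ∫ y in (0 : ℝ)..x, u y) (u b) b → u b - u a = ∫ y in a..b, v y := by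
    intro a b hab ha hb
    set χ : L2R := indicatorConstLp 2 (measurableSet_Ioc (a := a) (b := b))
      measure_Ioc_lt_top.ne (1 : ℂ)
    have hχ : ∀ f : L2R, innerSL ℂ χ f = ∫ y in a..b, f y := by
      intro f
      rw [innerSL_apply_apply, L2.inner_indicatorConstLp_one, intervalIntegral.integral_of_le hab]
    have h1 := ((innerSL ℂ χ).restrictScalars ℝ).hasFDerivAt.comp_hasDerivAt 0 h
    have h2 : ∀ t : ℝ, innerSL ℂ χ (translate t u) =
        (∫ y in (0 : ℝ)..(b + t), u y) - ∫ y in (0 : ℝ)..(a + t), u y := by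
      intro t
      rw [hχ, intervalIntegral.integral_interval_sub_left (u.intervalIntegrable _ _)
        (u.intervalIntegrable _ _),
        intervalIntegral.integral_congr_ae (g := fun y => u (y + t))
          ((coeFn_translate t u).mono fun x hx _ => hx),
        intervalIntegral.integral_comp_add_right]
    have hb' : HasDerivAt (fun x => ∫ y in (0 : ℝ)..x, u y) (u b) (b + 0) := by rwa [add_zero]
    have ha' : HasDerivAt (fun x => ∫ y in (0 : ℝ)..x, u y) (u a) (a + 0) := by rwa [add_zero]
    have h3 := (hb'.comp_const_add b 0).sub (ha'.comp_const_add a 0)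
    rw [← hχ]
    exact h3.unique (h1.congr_of_eventuallyEq (Eventually.of_forall fun t => (h2 t).symm))
  obtain ⟨a, ha⟩ := hL.exists
  refine ⟨u a, a, ?_⟩
  filter_upwards [hL] with x hx
  rcases le_total a x with hax | hax
  · rw [← key a x hax (ha 0) (hx 0)]; ring
  · rw [intervalIntegral.integral_symm, ← key x a hax (hx 0) (ha 0)]; ring

/-- Indefinite integrals of complex functions are absolutely continuous. -/
theorem absolutelyContinuousOnInterval_integral {v : ℝ → ℂ}
    (hv : ∀ a b, IntervalIntegrable v volume a b) (c a b : ℝ) :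
    AbsolutelyContinuousOnInterval (fun x => ∫ y in c..x, v y) a b := by
  have hre : ∀ a b, IntervalIntegrable (fun y => (v y).re) volume a b := fun a b =>
    ⟨(hv a b).1.re, (hv a b).2.re⟩
  have him : ∀ a b, IntervalIntegrable (fun y => (v y).im) volume a b := fun a b =>
    ⟨(hv a b).1.im, (hv a b).2.im⟩
  have hlip : ∀ (L : ℝ →L[ℝ] ℂ) (f : ℝ → ℝ), (∀ a b, IntervalIntegrable f volume a b) →
      (∀ x, ‖L x‖ = ‖x‖) → AbsolutelyContinuousOnInterval (fun x => L (∫ y in c..x, f y)) a b := by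
    intro L f hf hL
    have h1 : AbsolutelyContinuousOnInterval (fun x => ∫ y in c..x, f y) a b := by
      have h0 := (hf (min a (min b c)) (max a (max b c)))
        |>.absolutelyContinuousOnInterval_intervalIntegral (c := c) (by
          rw [mem_uIcc]; left; constructor <;> simp)
      refine h0.mono ?_
      rw [uIcc_of_le (show min a (min b c) ≤ max a (max b c) by simp)]
      exact Icc_subset_Icc
        (le_min (min_le_left _ _) ((min_le_right _ _).trans (min_le_left _ _)))
        (max_le (le_max_left _ _) ((le_max_left _ _).trans (le_max_right _ _)))
    rw [absolutelyContinuousOnInterval_iff] at h1 ⊢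
    intro ε hε
    obtain ⟨δ, hδ, h⟩ := h1 ε hε
    refine ⟨δ, hδ, fun E hE hE' => lt_of_eq_of_lt ?_ (h E hE hE')⟩
    refine Finset.sum_congr rfl fun i _ => ?_
    rw [dist_eq_norm, dist_eq_norm, ← map_sub, hL]
  have h1 := (hlip Complex.ofRealCLM _ hre (by simp)).add
    (hlip (Complex.I • Complex.ofRealCLM) _ him (by simp))
  refine (congrArg (fun f => AbsolutelyContinuousOnInterval f a b) ?_).mp h1
  ext x
  have hint : ∀ (L : ℝ →L[ℝ] ℂ) (f : ℝ → ℝ), IntervalIntegrable f volume c x →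
      IntervalIntegrable (fun y => L (f y)) volume c x := fun L f hf =>
    ⟨L.integrable_comp hf.1, L.integrable_comp hf.2⟩
  have h2 := intervalIntegral.integral_add
    (hint Complex.ofRealCLM _ (hre c x)) (hint (Complex.I • Complex.ofRealCLM) _ (him c x))
  rw [ContinuousLinearMap.intervalIntegral_comp_comm _ (hre c x),
    ContinuousLinearMap.intervalIntegral_comp_comm _ (him c x)] at h2
  rw [Pi.add_apply, ← h2]
  refine intervalIntegral.integral_congr fun y _ => ?_
  change ((v y).re : ℂ) + Complex.I * ((v y).im : ℂ) = v y
  rw [mul_comm, Complex.re_add_im]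

/-! ### Sewing a function on the line into a function on `Ω` -/

theorem norm_sq_eq_integral {X : Type*} [MeasurableSpace X] {μ : Measure X} (f : Lp ℂ 2 μ) :
    ‖f‖ ^ 2 = ∫ x, ‖f x‖ ^ 2 ∂μ := by
  have h := congrArg Complex.re (L2.inner_def (𝕜 := ℂ) f f)
  rw [inner_self_eq_norm_sq_to_K] at h
  have h2 : ∀ x, ⟪f x, f x⟫_ℂ = ((‖f x‖ ^ 2 : ℝ) : ℂ) := fun x => by
    rw [inner_self_eq_norm_sq_to_K]; norm_cast
  simp_rw [h2, integral_complex_ofReal] at h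
  exact_mod_cast h

theorem setIntegral_comp_add_right {E : Type*} [NormedAddCommGroup E] [NormedSpace ℝ E]
    (f : ℝ → E) (a : ℝ) (s : Set ℝ) :
    ∫ x in (fun x => x + a) ⁻¹' s, f (x + a) = ∫ x in s, f x :=
  (measurePreserving_add_right volume a).setIntegral_preimage_emb
    (measurableEmbedding_addRight a) f s

theorem setIntegral_Omega {E : Type*} [NormedAddCommGroup E] [NormedSpace ℝ E] {α β : ℝ}
    (hα : 1 < α) (hαβ : α < β) {f : ℝ → E} (hf : IntegrableOn f (Omega α β)) :
    ∫ x in Omega α β, f x = (∫ x in Iio 0, f x) + (∫ x in Ioo 1 α, f x) + ∫ x in Ioi β, f x := by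
  have h1 : Disjoint (Iio (0 : ℝ) ∪ Ioo 1 α) (Ioi β) := by
    rw [Set.disjoint_left]
    rintro x (hx | hx) (h : β < x)
    · exact absurd hx (by simp only [mem_Iio]; linarith)
    · linarith [hx.2]
  have h2 : Disjoint (Iio (0 : ℝ)) (Ioo 1 α) := by
    rw [Set.disjoint_left]
    intro x (hx : x < 0) h
    linarith [h.1]
  unfold Omega at hf ⊢
  rw [setIntegral_union h1 measurableSet_Ioi hf.left_of_union hf.right_of_union,
    setIntegral_union h2 measurableSet_Ioo hf.left_of_union.left_of_union
      hf.left_of_union.right_of_union]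

theorem memLp_comp_add_right {u : ℝ → ℂ} (h : MemLp u 2 volume) (a : ℝ) :
    MemLp (fun x => u (x + a)) 2 volume :=
  h.comp_measurePreserving (measurePreserving_add_right volume a)

/-- The boundary condition, solved for the values at `0` and `β`:
`f(0) = p (f(1) - c̄ f(α))` and `f(β) = q (f(α) - c f(1))`. Here `c̄` is the amplitude of
the return from `α` to `1`, and `|p|² = |q|² = 1 / (1 - |c|²)`. -/
structure Coupling (α β : ℝ) where
  /-- the complex conjugate of the amplitude with which a wave leaving `(1, α)` at `α` comes back
  at `1` -/
  c : ℂ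
  /-- the factor of the boundary value at `0` -/
  p : ℂ
  /-- the factor of the boundary value at `β` -/
  q : ℂ
  one_lt : 1 < α
  lt : α < β
  norm_c_lt : ‖c‖ < 1
  norm_p_sq : ‖p‖ ^ 2 * (1 - ‖c‖ ^ 2) = 1
  norm_q_sq : ‖q‖ ^ 2 * (1 - ‖c‖ ^ 2) = 1

namespace Coupling

variable {α β : ℝ} (S : Coupling α β)

theorem p_ne_zero : S.p ≠ 0 := by
  intro h; have := S.norm_p_sq; simp [h] at this

theorem q_ne_zero : S.q ≠ 0 := by
  intro h; have := S.norm_q_sq; simp [h] at this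

/-- The function on `Ω` that agrees with `u` on `(1, α)` and moves with `u`: translating `u`
corresponds to the motion on `Ω` under the boundary condition. On `(-∞, 0)` and `(β, ∞)` it is
the combination of two translates of `u` that the boundary condition prescribes. The values
off `Ω` are immaterial. -/
def sew (u : ℝ → ℂ) (x : ℝ) : ℂ :=
  if x < 0 then S.p * (u (x + 1) - conj S.c * u (x + α))
  else if x < α then u x
  else S.q * (u (x + (α - β)) - S.c * u (x + (1 - β)))

theorem sew_of_neg (u : ℝ → ℂ) {x : ℝ} (hx : x < 0) :
    S.sew u x = S.p * (u (x + 1) - conj S.c * u (x + α)) := if_pos hx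

theorem sew_of_mem_Ioo (u : ℝ → ℂ) {x : ℝ} (hx : x ∈ Ioo 1 α) : S.sew u x = u x := by
  rw [sew, if_neg (by linarith [hx.1]), if_pos hx.2]

theorem sew_of_gt (u : ℝ → ℂ) {x : ℝ} (hx : β < x) :
    S.sew u x = S.q * (u (x + (α - β)) - S.c * u (x + (1 - β))) := by
  have h1 := S.one_lt
  have h2 := S.lt
  rw [sew, if_neg (by linarith), if_neg (by linarith)]

theorem sew_add (u v : ℝ → ℂ) (x : ℝ) : S.sew (u + v) x = S.sew u x + S.sew v x := by
  simp only [sew, Pi.add_apply]; split_ifs <;> ring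

theorem sew_smul (a : ℂ) (u : ℝ → ℂ) (x : ℝ) : S.sew (a • u) x = a * S.sew u x := by
  simp only [sew, Pi.smul_apply, smul_eq_mul]; split_ifs <;> ring

theorem sew_eq_indicator (u : ℝ → ℂ) : S.sew u =
    (Iio 0).indicator (fun x => S.p * (u (x + 1) - conj S.c * u (x + α))) +
    (Ico 0 α).indicator u +
    (Ici α).indicator (fun x => S.q * (u (x + (α - β)) - S.c * u (x + (1 - β)))) := by
  have h1 := S.one_lt
  ext x
  simp only [sew, Pi.add_apply, indicator, mem_Iio, mem_Ico, mem_Ici]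
  rcases lt_or_ge x 0 with h | h
  · simp [h, not_le.2 h, show ¬ α ≤ x by linarith]
  · rcases lt_or_ge x α with h' | h'
    · simp [h', h, not_lt.2 h, not_le.2 h']
    · simp [h', not_lt.2 h, not_lt.2 h']

theorem sew_congr {u v : ℝ → ℂ} (h : u =ᵐ[volume] v) : S.sew u =ᵐ[volume] S.sew v := by
  filter_upwards [h, ae_comp_add_right h 1, ae_comp_add_right h α, ae_comp_add_right h (α - β),
    ae_comp_add_right h (1 - β)] with x h0 h1 h2 h3 h4
  simp only [sew, h0, h1, h2, h3, h4]

theorem memLp_sew {u : ℝ → ℂ} (h : MemLp u 2 volume) : MemLp (S.sew u) 2 volume := by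
  rw [S.sew_eq_indicator]
  refine ((MemLp.indicator measurableSet_Iio ?_).add (h.indicator measurableSet_Ico)).add
    (MemLp.indicator measurableSet_Ici ?_)
  · exact ((memLp_comp_add_right h 1).sub ((memLp_comp_add_right h α).const_mul _)).const_mul _
  · exact ((memLp_comp_add_right h _).sub ((memLp_comp_add_right h _).const_mul _)).const_mul _

/-- The map `u ↦ q (u(· + α) - c u(· + 1))` of `L²(ℝ)`. It commutes with translations, and
its values have the norm of the sewn function. -/
def transfer : L2R →L[ℂ] L2R :=
  S.q • ((translate α).toContinuousLinearMap - S.c • (translate 1).toContinuousLinearMap)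

theorem transfer_apply (u : L2R) :
    S.transfer u = S.q • (translate α u - S.c • translate 1 u) := rfl

theorem coeFn_transfer (u : L2R) :
    S.transfer u =ᵐ[volume] fun x => S.q * (u (x + α) - S.c * u (x + 1)) := by
  rw [transfer_apply]
  filter_upwards [Lp.coeFn_smul S.q (translate α u - S.c • translate 1 u),
    Lp.coeFn_sub (translate α u) (S.c • translate 1 u), Lp.coeFn_smul S.c (translate 1 u),
    coeFn_translate α u, coeFn_translate 1 u] with x h1 h2 h3 h4 h5
  simp only [h1, h2, h3, h4, h5, Pi.smul_apply, Pi.sub_apply, smul_eq_mul]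

theorem translate_transfer (a : ℝ) (u : L2R) :
    translate a (S.transfer u) = S.transfer (translate a u) := by
  simp only [transfer_apply, map_smul, map_sub, translate_translate, add_comm a]

theorem le_norm_transfer (u : L2R) : ‖S.q‖ * (1 - ‖S.c‖) * ‖u‖ ≤ ‖S.transfer u‖ := by
  rw [transfer_apply, norm_smul, mul_assoc]
  refine mul_le_mul_of_nonneg_left ?_ (norm_nonneg _)
  have := norm_sub_norm_le (translate α u) (S.c • translate 1 u)
  rw [norm_smul, LinearIsometry.norm_map, LinearIsometry.norm_map] at this
  linarith

/-- The pointwise identity behind unitarity: both combinations of two boundary values `a`, `b`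
have the same norm up to the flux `|a|² - |b|²`. -/
theorem norm_sq_sub (a b : ℂ) : ‖S.p * (a - conj S.c * b)‖ ^ 2 =
    ‖S.q * (b - S.c * a)‖ ^ 2 + (‖a‖ ^ 2 - ‖b‖ ^ 2) := by
  have hc : (1 - ‖S.c‖ ^ 2) ≠ 0 := by
    intro h; have := S.norm_p_sq; simp [h] at this
  have hpq : ‖S.p‖ ^ 2 = ‖S.q‖ ^ 2 :=
    mul_right_cancel₀ hc (S.norm_p_sq.trans S.norm_q_sq.symm)
  have h : ‖a - conj S.c * b‖ ^ 2 - ‖b - S.c * a‖ ^ 2 =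
      (1 - ‖S.c‖ ^ 2) * (‖a‖ ^ 2 - ‖b‖ ^ 2) := by
    simp only [← Complex.normSq_eq_norm_sq, Complex.normSq_apply, Complex.sub_re, Complex.sub_im,
      Complex.mul_re, Complex.mul_im, Complex.conj_re, Complex.conj_im]
    ring
  rw [norm_mul, norm_mul, mul_pow, mul_pow, hpq]
  linear_combination ‖S.q‖ ^ 2 * h + (‖a‖ ^ 2 - ‖b‖ ^ 2) * S.norm_q_sq

theorem integral_norm_sq_sew (u : L2R) :
    ∫ x in Omega α β, ‖S.sew u x‖ ^ 2 = ∫ x, ‖S.q * (u (x + α) - S.c * u (x + 1))‖ ^ 2 := by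
  have hα := S.one_lt
  have hi : ∀ {f : ℝ → ℂ}, MemLp f 2 volume → Integrable (fun x => ‖f x‖ ^ 2) := fun hf =>
    hf.integrable_norm_pow (by norm_num)
  have hu := Lp.memLp u
  set h : ℝ → ℝ := fun x => ‖S.q * (u (x + α) - S.c * u (x + 1))‖ ^ 2 with hh
  have hhi : Integrable h :=
    hi (((memLp_comp_add_right hu α).sub ((memLp_comp_add_right hu 1).const_mul _)).const_mul _)
  set n : ℝ → ℝ := fun x => ‖u x‖ ^ 2 with hn
  have hni : Integrable n := hi hu
  rw [setIntegral_Omega S.one_lt S.lt (hi (S.memLp_sew hu)).integrableOn]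
  have e1 : ∫ x in Iio 0, ‖S.sew u x‖ ^ 2 =
      (∫ x in Iio 0, h x) + ((∫ x in Iio 0, n (x + 1)) - ∫ x in Iio 0, n (x + α)) := by
    rw [← integral_sub (hni.comp_add_right 1).integrableOn (hni.comp_add_right α).integrableOn,
      ← integral_add (g := fun x => n (x + 1) - n (x + α)) hhi.integrableOn
        ((hni.comp_add_right 1).sub (hni.comp_add_right α)).integrableOn]
    refine setIntegral_congr_fun measurableSet_Iio fun x (hx : x < 0) => ?_
    simp only [S.sew_of_neg _ hx, S.norm_sq_sub, hh, hn]
  have e2 : ∫ x in Ioo 1 α, ‖S.sew u x‖ ^ 2 = ∫ x in Ioo 1 α, n x :=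
    setIntegral_congr_fun measurableSet_Ioo fun x hx => by simp only [S.sew_of_mem_Ioo _ hx, hn]
  have e3 : ∫ x in Ioi β, ‖S.sew u x‖ ^ 2 = ∫ x in Ioi 0, h x := by
    rw [← setIntegral_comp_add_right h (-β) (Ioi 0),
      show (fun x => x + -β) ⁻¹' Ioi 0 = Ioi β by ext x; simp]
    refine setIntegral_congr_fun measurableSet_Ioi fun x (hx : β < x) => ?_
    simp only [S.sew_of_gt _ hx, hh]
    rw [show x + (α - β) = x + -β + α by ring, show x + (1 - β) = x + -β + 1 by ring]
  have e4 : ∀ a : ℝ, ∫ x in Iio 0, n (x + a) = ∫ x in Iio a, n x := fun a => by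
    rw [← setIntegral_comp_add_right n a (Iio a),
      show (fun x => x + a) ⁻¹' Iio a = Iio 0 by ext x; simp]
  have e5 : ∫ x in Iio α, n x = (∫ x in Iio 1, n x) + ∫ x in Ioo 1 α, n x := by
    rw [← integral_Ico_eq_integral_Ioo, ← setIntegral_union _ measurableSet_Ico
      hni.integrableOn hni.integrableOn, Iio_union_Ico_eq_Iio hα.le]
    rw [Set.disjoint_left]
    exact fun x (hx : x < 1) h => absurd h.1 (not_le.2 hx)
  have e6 : ∫ x, h x = (∫ x in Iio 0, h x) + ∫ x in Ioi 0, h x := by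
    rw [← integral_Ici_eq_integral_Ioi, ← setIntegral_union _ measurableSet_Ici
      hhi.integrableOn hhi.integrableOn, Iio_union_Ici, setIntegral_univ]
    rw [Set.disjoint_left]
    exact fun x (hx : x < 0) h => absurd h (not_le.2 hx)
  rw [e1, e2, e3, e4, e4, e5, e6]
  ring

/-- Sewing as a linear map `L²(ℝ) → L²(Ω)`. -/
def sewLp : L2R →ₗ[ℂ] L2 α β where
  toFun u := ((S.memLp_sew (Lp.memLp u)).restrict (Omega α β)).toLp
  map_add' u v := by
    rw [← MemLp.toLp_add]
    refine MemLp.toLp_congr _ _ (ae_restrict_of_ae ?_)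
    filter_upwards [S.sew_congr (Lp.coeFn_add u v)] with x hx
    rw [hx, S.sew_add, Pi.add_apply]
  map_smul' a u := by
    rw [RingHom.id_apply, ← MemLp.toLp_const_smul]
    refine MemLp.toLp_congr _ _ (ae_restrict_of_ae ?_)
    filter_upwards [S.sew_congr (Lp.coeFn_smul a u)] with x hx
    rw [hx, S.sew_smul, Pi.smul_apply, smul_eq_mul]

theorem coeFn_sewLp (u : L2R) : S.sewLp u =ᵐ[volume.restrict (Omega α β)] S.sew u :=
  MemLp.coeFn_toLp ((S.memLp_sew (Lp.memLp u)).restrict (Omega α β))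

theorem coeFn_sewLp_of_ae_eq {u : L2R} {v : ℝ → ℂ} (h : u =ᵐ[volume] v) :
    S.sewLp u =ᵐ[volume.restrict (Omega α β)] S.sew v :=
  (S.coeFn_sewLp u).trans (ae_restrict_of_ae (S.sew_congr h))

theorem norm_sewLp (u : L2R) : ‖S.sewLp u‖ = ‖S.transfer u‖ := by
  rw [← sq_eq_sq₀ (norm_nonneg _) (norm_nonneg _), norm_sq_eq_integral, norm_sq_eq_integral]
  exact (integral_congr_ae ((S.coeFn_sewLp u).fun_comp fun z => ‖z‖ ^ 2)).trans
    ((S.integral_norm_sq_sew u).trans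
      (integral_congr_ae ((S.coeFn_transfer u).fun_comp fun z => ‖z‖ ^ 2)).symm)

theorem inner_sewLp (u v : L2R) :
    ⟪S.sewLp u, S.sewLp v⟫_ℂ = ⟪S.transfer u, S.transfer v⟫_ℂ := by
  simp only [inner_eq_sum_norm_sq_div_four, ← map_add, ← map_sub, ← map_smul, norm_sewLp]

end Coupling

/-! ### Sewing is a bijection of `L²(ℝ)` onto `L²(Ω)` -/

/-- The equation `u = c u(· + a) + b` on a set `s` has a solution that vanishes off `s`. -/
theorem exists_ae_eq_indicator_comp_add {s : Set ℝ} (hs : MeasurableSet s) {c : ℂ} (hc : ‖c‖ < 1)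
    (a : ℝ) {b : ℝ → ℂ} (hb : MemLp b 2 volume) :
    ∃ u : ℝ → ℂ, MemLp u 2 volume ∧ ∀ᵐ x, u x = s.indicator (fun x => c * u (x + a) + b x) x := by
  have hm : ∀ u : L2R, MemLp (s.indicator (c • translate a u : L2R)) 2 volume := fun u =>
    (Lp.memLp (c • translate a u)).indicator hs
  have hT : ∀ u, (hm u).toLp =ᵐ[volume] s.indicator fun x => c * u (x + a) := by
    intro u
    filter_upwards [(hm u).coeFn_toLp, Lp.coeFn_smul c (translate a u), coeFn_translate a u]
      with x h1 h2 h3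
    simp only [h1, indicator, h2, Pi.smul_apply, h3, smul_eq_mul]
  let T : L2R →ₗ[ℂ] L2R :=
    { toFun := fun u => (hm u).toLp
      map_add' := fun u v => by
        refine Lp.ext ?_
        filter_upwards [hT (u + v), hT u, hT v, Lp.coeFn_add (hm u).toLp (hm v).toLp,
          ae_comp_add_right (Lp.coeFn_add u v) a] with x h1 h2 h3 h4 h5
        rw [h4, Pi.add_apply, h1, h2, h3]
        simp only [indicator, h5, Pi.add_apply]
        split_ifs <;> ring
      map_smul' := fun z u => by
        refine Lp.ext ?_
        filter_upwards [hT (z • u), hT u, Lp.coeFn_smul z (hm u).toLp,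
          ae_comp_add_right (Lp.coeFn_smul z u) a] with x h1 h2 h3 h4
        rw [RingHom.id_apply, h3, Pi.smul_apply, h1, h2]
        simp only [indicator, h4, Pi.smul_apply, smul_eq_mul]
        split_ifs <;> ring }
  have hbm : MemLp (s.indicator b) 2 volume := hb.indicator hs
  obtain ⟨u, hu⟩ := exists_sub_map_eq T (norm_nonneg c) hc (fun u => by
    rw [← (translate a).norm_map u, ← norm_smul]
    refine Lp.norm_le_norm_of_ae_le ?_
    filter_upwards [(hm u).coeFn_toLp] with x hx
    exact (congrArg norm hx).trans_le (norm_indicator_le_norm_self _ _)) hbm.toLp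
  refine ⟨u, Lp.memLp u, ?_⟩
  have h0 : u =ᵐ[volume] ((hm u).toLp + hbm.toLp : L2R) := by
    exact Eq.eventuallyEq (congrArg (fun v : L2R => (v : ℝ → ℂ)) hu)
  filter_upwards [h0, Lp.coeFn_add (hm u).toLp hbm.toLp, hT u, hbm.coeFn_toLp] with x h1 h2 h3 h4
  rw [h1, h2, Pi.add_apply, h3, h4]
  simp only [indicator]
  split_ifs <;> simp

namespace Coupling

variable {α β : ℝ} (S : Coupling α β)

theorem sewLp_injective : Function.Injective S.sewLp := by
  rw [← LinearMap.ker_eq_bot, LinearMap.ker_eq_bot']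
  intro u hu
  have h := S.le_norm_transfer u
  rw [← norm_sewLp, hu, norm_zero] at h
  have hp : 0 < ‖S.q‖ * (1 - ‖S.c‖) :=
    mul_pos (norm_pos_iff.2 S.q_ne_zero) (by linarith [S.norm_c_lt])
  exact norm_eq_zero.1 (le_antisymm (nonpos_of_mul_nonpos_right h hp) (norm_nonneg _))

/-- The line function `u` equals `f` on `(1, α)`, and the remaining parts of `f`
prescribe `u` on `(α, ∞)` and `(-∞, 1)` recursively, by strict contractions. -/
theorem sewLp_surjective : Function.Surjective S.sewLp := by
  intro f
  have hα := S.one_lt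
  have hαβ := S.lt
  have hc : ‖conj S.c‖ < 1 := by rw [RCLike.norm_conj]; exact S.norm_c_lt
  -- A preimage is `m + uR + uL`, with `m`, `uR`, `uL` supported in `(1, α)`, `[α, ∞)`, `(-∞, 1]`.
  set F : ℝ → ℂ := (Omega α β).indicator f with hF
  have hFm : MemLp F 2 volume :=
    (memLp_indicator_iff_restrict (isOpen_Omega α β).measurableSet).2 (Lp.memLp f)
  set m : ℝ → ℂ := (Ioo 1 α).indicator F with hm
  have hmm : MemLp m 2 volume := hFm.indicator measurableSet_Ioo
  obtain ⟨uR, hR, hRe⟩ := exists_ae_eq_indicator_comp_add (measurableSet_Ioi (a := α)) S.norm_c_lt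
    (1 - α) (b := fun x => S.c * m (x + (1 - α)) + S.q⁻¹ * F (x + (β - α)))
    (((memLp_comp_add_right hmm _).const_mul _).add ((memLp_comp_add_right hFm _).const_mul _))
  obtain ⟨uL, hL, hLe⟩ := exists_ae_eq_indicator_comp_add (measurableSet_Iio (a := 1)) hc
    (α - 1) (b := fun x => conj S.c * m (x + (α - 1)) + S.p⁻¹ * F (x + -1))
    (((memLp_comp_add_right hmm _).const_mul _).add ((memLp_comp_add_right hFm _).const_mul _))
  have hu : MemLp (m + uR + uL) 2 volume := (hmm.add hR).add hL
  refine ⟨hu.toLp _, Lp.ext ?_⟩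
  have h1 := S.coeFn_sewLp_of_ae_eq hu.coeFn_toLp
  refine h1.trans ?_
  have hm0 : ∀ {x}, x ∉ Ioo 1 α → m x = 0 := fun h => indicator_of_notMem h _
  rw [EventuallyEq, ae_restrict_iff' (isOpen_Omega α β).measurableSet]
  filter_upwards [hRe, hLe, ae_comp_add_right hRe (α - β), ae_comp_add_right hLe (α - β),
    ae_comp_add_right hRe (1 - β), ae_comp_add_right hLe (1 - β), ae_comp_add_right hRe 1,
    ae_comp_add_right hLe 1, ae_comp_add_right hRe α, ae_comp_add_right hLe α,
    Measure.ae_ne volume α, Measure.ae_ne volume 1]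
    with x r0 l0 r1 l1 r2 l2 r3 l3 r4 l4 _ _ hx
  have hFx : F x = f x := indicator_of_mem hx _
  rw [← hFx]
  have hp := S.p_ne_zero
  have hq := S.q_ne_zero
  rcases hx with (hx | hx) | hx
  · have hx : x < 0 := hx
    rw [S.sew_of_neg _ hx]
    simp only [Pi.add_apply]
    rw [indicator_of_notMem (by simp only [mem_Ioi]; linarith)] at r3 r4
    rw [indicator_of_mem (by simp only [mem_Iio]; linarith)] at l3
    rw [hm0 (fun h => by linarith [h.1]), r3, r4, l3, show x + 1 + (α - 1) = x + α by ring,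
      show x + 1 + -1 = x by ring]
    field_simp
    ring
  · rw [S.sew_of_mem_Ioo _ hx]
    simp only [Pi.add_apply]
    rw [indicator_of_notMem (by simp only [mem_Ioi]; linarith [hx.2])] at r0
    rw [indicator_of_notMem (by simp only [mem_Iio]; linarith [hx.1])] at l0
    rw [r0, l0, hm, indicator_of_mem hx]
    ring
  · have hx : β < x := hx
    rw [S.sew_of_gt _ hx]
    simp only [Pi.add_apply]
    rw [indicator_of_mem (by simp only [mem_Ioi]; linarith)] at r1
    rw [indicator_of_notMem (by simp only [mem_Iio]; linarith)] at l1 l2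
    rw [hm0 (x := x + (α - β)) (fun h => by linarith [h.2]), r1, l1, l2,
      show x + (α - β) + (1 - α) = x + (1 - β) by ring,
      show x + (α - β) + (β - α) = x by ring]
    field_simp
    ring

/-- Sewing as an isomorphism of `L²(ℝ)` onto `L²(Ω)`. -/
def sewEquiv : L2R ≃L[ℂ] L2 α β :=
  LinearEquiv.toContinuousLinearEquivOfBounds
    (LinearEquiv.ofBijective S.sewLp ⟨S.sewLp_injective, S.sewLp_surjective⟩)
    ‖S.transfer‖ (‖S.q‖ * (1 - ‖S.c‖))⁻¹
    (fun u => by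
      change ‖S.sewLp u‖ ≤ _
      rw [norm_sewLp]; exact S.transfer.le_opNorm u)
    (fun f => by
      set u := (LinearEquiv.ofBijective S.sewLp ⟨S.sewLp_injective, S.sewLp_surjective⟩).symm f
        with hu
      have h : S.sewLp u = f :=
        (LinearEquiv.ofBijective S.sewLp ⟨S.sewLp_injective, S.sewLp_surjective⟩).apply_symm_apply f
      have hp : 0 < ‖S.q‖ * (1 - ‖S.c‖) :=
        mul_pos (norm_pos_iff.2 S.q_ne_zero) (by linarith [S.norm_c_lt])
      rw [← div_eq_inv_mul, le_div_iff₀' hp, ← h, norm_sewLp]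
      exact S.le_norm_transfer u)

theorem coeFn_sewEquiv (u : L2R) :
    S.sewEquiv u =ᵐ[volume.restrict (Omega α β)] S.sew u := S.coeFn_sewLp u

theorem norm_sewEquiv (u : L2R) : ‖S.sewEquiv u‖ = ‖S.transfer u‖ := S.norm_sewLp u

theorem norm_sewEquiv_translate (a : ℝ) (u : L2R) :
    ‖S.sewEquiv (translate a u)‖ = ‖S.sewEquiv u‖ := by
  rw [norm_sewEquiv, norm_sewEquiv, ← translate_transfer, LinearIsometry.norm_map]

/-- The motion on `Ω`: translation to the right on the line, conjugated by sewing. -/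
def group : UnitaryGroup (L2 α β) where
  op t :=
    { toFun := fun f => S.sewEquiv (translate (-t) (S.sewEquiv.symm f))
      map_add' := fun f g => by simp only [map_add]
      map_smul' := fun a f => by simp only [map_smul, RingHom.id_apply]
      invFun := fun f => S.sewEquiv (translate t (S.sewEquiv.symm f))
      left_inv := fun f => by
        simp only [ContinuousLinearEquiv.symm_apply_apply, translate_translate, add_neg_cancel,
          translate_zero, ContinuousLinearEquiv.apply_symm_apply]
      right_inv := fun f => by
        simp only [ContinuousLinearEquiv.symm_apply_apply, translate_translate, neg_add_cancel,
          translate_zero, ContinuousLinearEquiv.apply_symm_apply]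
      norm_map' := fun f => by
        change ‖S.sewEquiv (translate (-t) (S.sewEquiv.symm f))‖ = ‖f‖
        rw [norm_sewEquiv_translate, ContinuousLinearEquiv.apply_symm_apply] }
  op_zero f := by
    change S.sewEquiv (translate (-0) (S.sewEquiv.symm f)) = f
    rw [neg_zero, translate_zero, ContinuousLinearEquiv.apply_symm_apply]
  op_add s t f := by
    change S.sewEquiv (translate (-(s + t)) (S.sewEquiv.symm f)) = S.sewEquiv (translate (-s)
      (S.sewEquiv.symm (S.sewEquiv (translate (-t) (S.sewEquiv.symm f)))))
    rw [ContinuousLinearEquiv.symm_apply_apply, translate_translate, neg_add]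
  continuous_op f := S.sewEquiv.continuous.comp
    ((continuous_translate (S.sewEquiv.symm f)).comp continuous_neg)

theorem group_op (t : ℝ) (f : L2 α β) :
    S.group.op t f = S.sewEquiv (translate (-t) (S.sewEquiv.symm f)) := rfl

end Coupling

/-! ### The generator of the sewn translation group -/

theorem absolutelyContinuousOnInterval_congr {F G : ℝ → ℂ} {a b : ℝ}
    (hF : AbsolutelyContinuousOnInterval F a b) (h : EqOn F G (uIcc a b)) :
    AbsolutelyContinuousOnInterval G a b := by
  rw [absolutelyContinuousOnInterval_iff] at hF ⊢
  intro ε hε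
  obtain ⟨δ, hδ, hd⟩ := hF ε hε
  refine ⟨δ, hδ, fun E hE hE' => lt_of_eq_of_lt ?_ (hd E hE hE')⟩
  exact Finset.sum_congr rfl fun i hi => by rw [h (hE.1 i hi).1, h (hE.1 i hi).2]

theorem Icc_subset_Omega {α β a b : ℝ} (hα : 1 < α) (hαβ : α < β) (hab : a ≤ b)
    (h : Icc a b ⊆ Omega α β) : b < 0 ∨ (1 < a ∧ b < α) ∨ β < a := by
  have h0 : ∀ x, x ∈ Omega α β → x < 0 ∨ (1 < x ∧ x < α) ∨ β < x := by
    rintro x ((hx | hx) | hx)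
    · exact Or.inl hx
    · exact Or.inr (Or.inl hx)
    · exact Or.inr (Or.inr hx)
  have key : ∀ x, ¬ (x < 0 ∨ (1 < x ∧ x < α) ∨ β < x) → x < a ∨ b < x := by
    intro x hx
    by_contra! hc
    exact hx (h0 x (h ⟨hc.1, hc.2⟩))
  have k0 := key 0 (by rintro (h | h | h) <;> linarith)
  have k1 := key α (by rintro (h | h | h) <;> linarith)
  rcases h0 a (h (left_mem_Icc.2 hab)) with ha | ha | ha
  · left
    rcases k0 with k | k <;> linarith
  · right; left
    refine ⟨ha.1, ?_⟩
    rcases k1 with k | k <;> linarith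
  · exact Or.inr (Or.inr ha)

namespace Coupling

variable {α β : ℝ} (S : Coupling α β)

/-- The boundary condition of the matrix `B` is the one given by the coupling. -/
def Represents (B : Matrix (Fin 2) (Fin 2) ℂ) : Prop :=
  ∀ v₀ v₁ vα vβ : ℂ, B *ᵥ ![v₁, vβ] = ![v₀, vα] ↔
    v₀ = S.p * (v₁ - conj S.c * vα) ∧ vβ = S.q * (vα - S.c * v₁)

theorem boundaryCondition_sew {B : Matrix (Fin 2) (Fin 2) ℂ} (hB : S.Represents B) {W : ℝ → ℂ}
    (hW : Continuous W) : BoundaryCondition α β B (S.sew W) := by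
  have hα := S.one_lt
  refine ⟨S.p * (W 1 - conj S.c * W α), W 1, W α, S.q * (W α - S.c * W 1), ?_, ?_, ?_, ?_,
    (hB _ _ _ _).2 ⟨rfl, rfl⟩⟩
  · have h : Continuous fun x => S.p * (W (x + 1) - conj S.c * W (x + α)) := by fun_prop
    have h1 := (h.tendsto 0).mono_left (nhdsWithin_le_nhds (s := Iio 0))
    simp only [zero_add] at h1
    refine h1.congr' ?_
    filter_upwards [self_mem_nhdsWithin] with x hx
    exact (S.sew_of_neg W hx).symm
  · refine ((hW.tendsto 1).mono_left nhdsWithin_le_nhds).congr' ?_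
    filter_upwards [Ioo_mem_nhdsGT hα] with x hx
    exact (S.sew_of_mem_Ioo W hx).symm
  · refine ((hW.tendsto α).mono_left nhdsWithin_le_nhds).congr' ?_
    filter_upwards [Ioo_mem_nhdsLT hα] with x hx
    exact (S.sew_of_mem_Ioo W hx).symm
  · have h : Continuous fun x => S.q * (W (x + (α - β)) - S.c * W (x + (1 - β))) := by fun_prop
    have h1 := (h.tendsto β).mono_left (nhdsWithin_le_nhds (s := Ioi β))
    simp only [add_sub_cancel] at h1
    refine h1.congr' ?_
    filter_upwards [self_mem_nhdsWithin] with x hx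
    exact (S.sew_of_gt W hx).symm

theorem isACOn_sew {W : ℝ → ℂ}
    (hW : ∀ s a b, AbsolutelyContinuousOnInterval (fun x => W (x + s)) a b) :
    IsACOn α β (S.sew W) := by
  intro a b hab h
  rcases Icc_subset_Omega S.one_lt S.lt hab h with hb | ⟨ha, hb⟩ | ha
  · refine absolutelyContinuousOnInterval_congr
      (((hW 1 a b).sub ((hW α a b).const_smul (conj S.c))).const_smul S.p) fun x hx => ?_
    rw [uIcc_of_le hab] at hx
    exact (S.sew_of_neg W (hx.2.trans_lt hb)).symm
  · refine absolutelyContinuousOnInterval_congr (hW 0 a b) fun x hx => ?_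
    rw [uIcc_of_le hab] at hx
    rw [S.sew_of_mem_Ioo W ⟨ha.trans_le hx.1, hx.2.trans_lt hb⟩, add_zero]
  · refine absolutelyContinuousOnInterval_congr
      (((hW (α - β) a b).sub ((hW (1 - β) a b).const_smul S.c)).const_smul S.q) fun x hx => ?_
    rw [uIcc_of_le hab] at hx
    exact (S.sew_of_gt W (ha.trans_le hx.1)).symm

theorem ae_hasDerivAt_sew {W V : ℝ → ℂ} (h : ∀ᵐ x, HasDerivAt W (V x) x) :
    ∀ᵐ x ∂(volume.restrict (Omega α β)), HasDerivAt (S.sew W) (S.sew V x) x := by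
  have hs : ∀ s : ℝ, ∀ᵐ x, HasDerivAt (fun x => W (x + s)) (V (x + s)) x := fun s =>
    (ae_comp_add_right h s).mono fun x hx => hx.comp_add_const x s
  rw [ae_restrict_iff' (isOpen_Omega α β).measurableSet]
  filter_upwards [h, hs 1, hs α, hs (α - β), hs (1 - β)] with x h0 h1 h2 h3 h4 hx
  rcases hx with (hx | hx) | hx
  · rw [S.sew_of_neg _ hx]
    refine ((h1.sub (h2.const_mul (conj S.c))).const_mul S.p).congr_of_eventuallyEq ?_
    filter_upwards [Iio_mem_nhds hx] with y hy
    exact S.sew_of_neg W hy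
  · rw [S.sew_of_mem_Ioo _ hx]
    refine h0.congr_of_eventuallyEq ?_
    filter_upwards [Ioo_mem_nhds hx.1 hx.2] with y hy
    exact S.sew_of_mem_Ioo W hy
  · rw [S.sew_of_gt _ hx]
    refine ((h3.sub (h4.const_mul S.c)).const_mul S.q).congr_of_eventuallyEq ?_
    filter_upwards [Ioi_mem_nhds hx] with y hy
    exact S.sew_of_gt W hy

/-- The generator of the sewn translation group is a restriction of the momentum operator. -/
theorem isMomentum_of_hasDerivAt {B : Matrix (Fin 2) (Fin 2) ℂ} (hB : S.Represents B)
    {f g : L2 α β}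
    (h : HasDerivAt (fun t : ℝ => S.group.op t f) (-(2 * Real.pi * Complex.I) • g) 0) :
    IsMomentum α β B f g := by
  set u := S.sewEquiv.symm f with hu
  set v := S.sewEquiv.symm g with hv
  have hd : HasDerivAt (fun t : ℝ => translate t u) ((2 * Real.pi * Complex.I) • v) 0 := by
    have h1 := ((S.sewEquiv.symm : L2 α β →L[ℂ] L2R).restrictScalars ℝ).hasFDerivAt
      |>.comp_hasDerivAt 0 h
    have h2 : HasDerivAt (fun t : ℝ => translate (-t) u) (-(2 * Real.pi * Complex.I) • v) (-0) := by
      rw [neg_zero]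
      refine (h1.congr_of_eventuallyEq (Eventually.of_forall fun t => ?_)).congr_deriv ?_
      · change _ = S.sewEquiv.symm (S.group.op t f)
        rw [group_op, ContinuousLinearEquiv.symm_apply_apply]
      · change S.sewEquiv.symm (-(2 * Real.pi * Complex.I) • g) = _
        rw [map_smul]
    have h3 := HasDerivAt.scomp (0 : ℝ) h2 (hasDerivAt_neg (0 : ℝ))
    refine (h3.congr_of_eventuallyEq (Eventually.of_forall fun t => ?_)).congr_deriv ?_
    · simp
    · simp
  obtain ⟨k, a, hk⟩ := ae_eq_integral_of_hasDerivAt_translate hd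
  set V : L2R := (2 * Real.pi * Complex.I) • v with hV
  set W : ℝ → ℂ := fun x => k + ∫ y in a..x, V y with hW
  have hVi : ∀ a b, IntervalIntegrable V volume a b := fun a b => V.intervalIntegrable a b
  have hWc : Continuous W :=
    continuous_const.add (intervalIntegral.continuous_primitive hVi a)
  have hWac : ∀ s x y, AbsolutelyContinuousOnInterval (fun z => W (z + s)) x y := by
    intro s x y
    have h1 := absolutelyContinuousOnInterval_integral (v := fun z => V (z + s))
      (fun a b => by simpa using (hVi (a + s) (b + s)).comp_add_right s) (a - s) x y
    have h2 : AbsolutelyContinuousOnInterval (fun _ : ℝ => k) x y :=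
      (contDiff_const.contDiffOn).absolutelyContinuousOnInterval
    refine absolutelyContinuousOnInterval_congr (h2.add h1) fun z _ => ?_
    simp [hW, intervalIntegral.integral_comp_add_right]
  have hWd : ∀ᵐ x, HasDerivAt W (V x) x := by
    filter_upwards [LocallyIntegrable.ae_hasDerivAt_integral
      ((Lp.memLp V).locallyIntegrable (by norm_num) : LocallyIntegrable V volume)] with x hx
    exact (hx a).const_add k
  refine ⟨S.sew W, S.isACOn_sew hWac, S.boundaryCondition_sew hB hWc, ?_, ?_⟩
  · have h1 := S.coeFn_sewLp_of_ae_eq hk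
    have h2 : S.sewLp u = f := S.sewEquiv.apply_symm_apply f
    rwa [h2] at h1
  · have h1 := S.coeFn_sewLp_of_ae_eq (Lp.coeFn_smul (2 * Real.pi * Complex.I) v)
    have h2 := S.coeFn_sewEquiv v
    rw [hv, S.sewEquiv.apply_symm_apply g, ← hv] at h2
    filter_upwards [S.ae_hasDerivAt_sew hWd, h2,
      ae_restrict_of_ae (S.sew_congr (Lp.coeFn_smul (2 * Real.pi * Complex.I) v))] with x h3 h4 h5
    rw [h4, h3.deriv, hV, h5, S.sew_smul, ← mul_assoc, inv_mul_cancel₀ Complex.two_pi_I_ne_zero,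
      one_mul]

end Coupling

/-! ### Absence of eigenvectors -/

/-- A function which is square integrable over a set of infinite measure has no positive lower
bound on that set. -/
theorem eq_zero_of_memLp_of_le {s : Set ℝ} (hs : MeasurableSet s) (hsv : volume s = ∞)
    {F : ℝ → ℂ} (hF : MemLp F 2 (volume.restrict s)) {k : ℝ} (hk0 : 0 ≤ k)
    (hk : ∀ x ∈ s, k ≤ ‖F x‖) : k = 0 := by
  by_contra hne
  have h1 : MemLp (fun _ : ℝ => k) 2 (volume.restrict s) := by
    refine hF.mono aestronglyMeasurable_const ?_
    filter_upwards [ae_restrict_mem hs] with x hx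
    rw [Real.norm_of_nonneg hk0]
    exact hk x hx
  rw [memLp_const_iff (by norm_num) (by norm_num)] at h1
  rcases h1 with h1 | h1
  · exact hne h1
  · rw [Measure.restrict_apply_univ, hsv] at h1
    exact lt_irrefl _ h1

/-- A locally absolutely continuous solution of `F' = κF` is a multiple of `exp(κx)` on each
interval contained in `Ω`. -/
theorem eq_mul_exp_of_deriv_eq {α β : ℝ} {F : ℝ → ℂ} (hF : IsACOn α β F) {κ : ℂ}
    (hd : ∀ᵐ x ∂(volume.restrict (Omega α β)), deriv F x = κ * F x) {I : Set ℝ}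
    (hI : I.OrdConnected) (hIΩ : I ⊆ Omega α β) {x₀ : ℝ} (hx₀ : x₀ ∈ I) :
    ∃ k : ℂ, ∀ x ∈ I, F x = k * Complex.exp (κ * x) := by
  have hexp : ∀ x : ℝ, HasDerivAt (fun x : ℝ => Complex.exp (-κ * x))
      (Complex.exp (-κ * x) * -κ) x := by
    intro x
    have h0 : HasDerivAt (fun t : ℝ => -κ * (t : ℂ)) (-κ * 1) x :=
      (Complex.ofRealCLM.hasDerivAt (x := x)).const_mul (-κ)
    simpa using h0.cexp
  have hcd : ContDiff ℝ 1 (fun x : ℝ => Complex.exp (-κ * x)) := by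
    have : ContDiff ℝ 1 (fun x : ℝ => (x : ℂ)) := Complex.ofRealCLM.contDiff
    fun_prop
  have key : ∀ a b, a ≤ b → a ∈ I → b ∈ I →
      Complex.exp (-κ * a) * F a = Complex.exp (-κ * b) * F b := by
    intro a b hab ha hb
    have hsub : Icc a b ⊆ Omega α β := (hI.out ha hb).trans hIΩ
    have h1 := (hcd.contDiffOn (s := uIcc a b)).absolutelyContinuousOnInterval.smul
      (hF a b hab hsub)
    have h2 : ∀ᵐ x, x ∈ uIcc a b →
        HasDerivAt ((fun x : ℝ => Complex.exp (-κ * x)) • F) 0 x := by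
      have h3 := (ae_restrict_iff' (isOpen_Omega α β).measurableSet).1 hd
      have h4 := (ae_restrict_iff' (isOpen_Omega α β).measurableSet).1 hF.ae_differentiableAt
      filter_upwards [h3, h4] with x hx3 hx4 hx
      rw [uIcc_of_le hab] at hx
      have h5 := (hexp x).smul (hx4 (hsub hx)).hasDerivAt
      refine h5.congr_deriv ?_
      rw [hx3 (hsub hx)]
      simp only [smul_eq_mul]; ring
    obtain ⟨C, hC⟩ := h1.const_of_ae_hasDerivAt_zero h2
    have ha' := hC a left_mem_uIcc
    have hb' := hC b right_mem_uIcc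
    exact ha'.trans hb'.symm
  refine ⟨Complex.exp (-κ * x₀) * F x₀, fun x hx => ?_⟩
  have h : Complex.exp (-κ * x₀) * F x₀ = Complex.exp (-κ * x) * F x := by
    rcases le_total x₀ x with h | h
    · exact key _ _ h hx₀ hx
    · exact (key _ _ h hx hx₀).symm
  rw [h, mul_right_comm, ← Complex.exp_add]
  simp

theorem eq_mul_exp_of_tendsto {F : ℝ → ℂ} {k κ v : ℂ} {x : ℝ} {l : Filter ℝ} [l.NeBot]
    (hl : l ≤ 𝓝 x)
    (h : ∀ᶠ y in l, F y = k * Complex.exp (κ * y)) (hv : Tendsto F l (𝓝 v)) :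
    v = k * Complex.exp (κ * x) := by
  have hc : Continuous fun y : ℝ => k * Complex.exp (κ * y) := by fun_prop
  exact tendsto_nhds_unique hv (((hc.tendsto x).mono_left hl).congr' (h.mono fun y hy => hy.symm))

namespace Coupling

variable {α β : ℝ} (S : Coupling α β)

/-- An eigenvector is a multiple of an exponential on each component of `Ω`. Being square
integrable it vanishes on one of the two half lines, so that `(1, α)` only feeds itself, with
amplitude of modulus below `1`; hence it vanishes on `(1, α)`, and then everywhere. -/
theorem eq_zero_of_isMomentum_smul {B : Matrix (Fin 2) (Fin 2) ℂ} (hB : S.Represents B)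
    {z : ℂ} {f : L2 α β} (h : IsMomentum α β B f (z • f)) : f = 0 := by
  obtain ⟨F, hF, ⟨v₀, v₁, vα, vβ, h0, h1, ha, hb, hbc⟩, hfF, hg⟩ := h
  have hα := S.one_lt
  obtain ⟨e0, eβ⟩ := (hB _ _ _ _).1 hbc
  set κ : ℂ := 2 * Real.pi * Complex.I * z with hκ
  have hd : ∀ᵐ x ∂(volume.restrict (Omega α β)), deriv F x = κ * F x := by
    filter_upwards [hg, hfF, Lp.coeFn_smul z f] with x h1 h2 h3
    rw [h3, Pi.smul_apply, h2, smul_eq_mul] at h1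
    rw [hκ, mul_assoc, h1, ← mul_assoc, mul_inv_cancel₀ Complex.two_pi_I_ne_zero, one_mul]
  obtain ⟨kL, hkL⟩ := eq_mul_exp_of_deriv_eq hF hd (ordConnected_Iio (a := (0 : ℝ)))
    (fun x hx => Or.inl (Or.inl hx)) (show (-1 : ℝ) ∈ Iio 0 by norm_num)
  obtain ⟨k, hk⟩ := eq_mul_exp_of_deriv_eq hF hd (ordConnected_Ioo (a := (1 : ℝ)) (b := α))
    (fun x hx => Or.inl (Or.inr hx)) (show (1 + α) / 2 ∈ Ioo 1 α by constructor <;> linarith)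
  obtain ⟨kR, hkR⟩ := eq_mul_exp_of_deriv_eq hF hd (ordConnected_Ioi (a := β))
    (fun x hx => Or.inr hx) (show β + 1 ∈ Ioi β by simp)
  have l0 : v₀ = kL * Complex.exp (κ * (0 : ℝ)) :=
    eq_mul_exp_of_tendsto nhdsWithin_le_nhds (eventually_nhdsWithin_of_forall hkL) h0
  have l1 : v₁ = k * Complex.exp (κ * (1 : ℝ)) :=
    eq_mul_exp_of_tendsto nhdsWithin_le_nhds (by filter_upwards [Ioo_mem_nhdsGT hα] using hk) h1
  have la : vα = k * Complex.exp (κ * α) :=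
    eq_mul_exp_of_tendsto nhdsWithin_le_nhds (by filter_upwards [Ioo_mem_nhdsLT hα] using hk) ha
  have lb : vβ = kR * Complex.exp (κ * β) :=
    eq_mul_exp_of_tendsto nhdsWithin_le_nhds (eventually_nhdsWithin_of_forall hkR) hb
  have hFm : MemLp F 2 (volume.restrict (Omega α β)) := (memLp_congr_ae hfF).1 (Lp.memLp f)
  have hnexp : ∀ x : ℝ, ‖Complex.exp (κ * x)‖ = Real.exp (-(2 * Real.pi * z.im * x)) := by
    intro x
    rw [Complex.norm_exp]
    congr 1
    simp [hκ]
  have hvα : ‖vα‖ = ‖v₁‖ * Real.exp (-(2 * Real.pi * z.im * (α - 1))) := by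
    rw [la, l1, norm_mul, norm_mul, hnexp, hnexp, mul_assoc ‖k‖, ← Real.exp_add]
    congr 2; ring
  have hne : ∀ x : ℝ, Complex.exp (κ * x) ≠ 0 := fun x => Complex.exp_ne_zero _
  have hfin : kL = 0 ∧ k = 0 ∧ kR = 0 := by
    -- For `Im z ≥ 0` the exponential does not decay at `-∞`, for `Im z ≤ 0` not at `+∞`.
    rcases le_total 0 z.im with hz | hz
    · have hL : kL = 0 := by
        rw [← norm_eq_zero]
        refine eq_zero_of_memLp_of_le (measurableSet_Iio (a := (0 : ℝ))) Real.volume_Iio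
          (hFm.mono_measure (Measure.restrict_mono (fun x hx => Or.inl (Or.inl hx)) le_rfl))
          (norm_nonneg _) fun x (hx : x < 0) => ?_
        rw [hkL x hx, norm_mul, hnexp]
        refine le_mul_of_one_le_right (norm_nonneg _) (Real.one_le_exp ?_)
        have : 0 ≤ 2 * Real.pi * z.im := by positivity
        nlinarith
      have hle : ‖vα‖ ≤ ‖v₁‖ := by
        rw [hvα]
        refine mul_le_of_le_one_right (norm_nonneg _) (Real.exp_le_one_iff.2 ?_)
        have : 0 ≤ 2 * Real.pi * z.im * (α - 1) :=
          mul_nonneg (by positivity) (by linarith)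
        linarith
      have hv : v₁ = conj S.c * vα := by
        rw [l0, hL, zero_mul] at e0
        exact sub_eq_zero.1 ((mul_eq_zero.1 e0.symm).resolve_left S.p_ne_zero)
      have hv1 : v₁ = 0 := by
        have h2 : ‖v₁‖ = ‖S.c‖ * ‖vα‖ := by
          conv_lhs => rw [hv]
          rw [norm_mul, RCLike.norm_conj]
        by_contra h3
        have h4 := norm_pos_iff.2 h3
        nlinarith [S.norm_c_lt, norm_nonneg S.c]
      have hk0 : k = 0 := by
        rw [l1] at hv1
        exact (mul_eq_zero.1 hv1).resolve_right (hne _)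
      refine ⟨hL, hk0, ?_⟩
      rw [la, hv1, hk0, lb] at eβ
      simpa using eβ
    · have hR : kR = 0 := by
        rw [← norm_eq_zero]
        have h2 : ‖kR‖ * Real.exp (-(2 * Real.pi * z.im * β)) = 0 := by
          refine eq_zero_of_memLp_of_le (measurableSet_Ioi (a := β)) Real.volume_Ioi
            (hFm.mono_measure (Measure.restrict_mono (fun x hx => Or.inr hx) le_rfl))
            (by positivity) fun x (hx : β < x) => ?_
          rw [hkR x hx, norm_mul, hnexp]
          gcongr ?_ * Real.exp ?_
          have : 0 ≤ 2 * Real.pi * (-z.im) := mul_nonneg (by positivity) (by linarith)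
          nlinarith
        exact (mul_eq_zero.1 h2).resolve_right (Real.exp_pos _).ne'
      have hle : ‖v₁‖ ≤ ‖vα‖ := by
        rw [hvα]
        refine le_mul_of_one_le_right (norm_nonneg _) (Real.one_le_exp ?_)
        have : 0 ≤ 2 * Real.pi * (-z.im) * (α - 1) :=
          mul_nonneg (mul_nonneg (by positivity) (by linarith)) (by linarith)
        linarith
      have hv : vα = S.c * v₁ := by
        rw [lb, hR, zero_mul] at eβ
        exact sub_eq_zero.1 ((mul_eq_zero.1 eβ.symm).resolve_left S.q_ne_zero)
      have hv1 : v₁ = 0 := by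
        have h2 : ‖vα‖ = ‖S.c‖ * ‖v₁‖ := by rw [hv, norm_mul]
        by_contra h3
        have h4 := norm_pos_iff.2 h3
        nlinarith [S.norm_c_lt, norm_nonneg S.c]
      have hk0 : k = 0 := by
        rw [l1] at hv1
        exact (mul_eq_zero.1 hv1).resolve_right (hne _)
      refine ⟨?_, hk0, hR⟩
      rw [la, hv1, hk0, l0] at e0
      simpa using e0
  refine Lp.ext ?_
  filter_upwards [hfF, Lp.coeFn_zero ℂ 2 (volume.restrict (Omega α β)),
    ae_restrict_mem (isOpen_Omega α β).measurableSet] with x h1 h2 hx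
  rw [h1, h2, Pi.zero_apply]
  rcases hx with (hx | hx) | hx
  · rw [hkL x hx, hfin.1, zero_mul]
  · rw [hk x hx, hfin.2.1, zero_mul]
  · rw [hkR x hx, hfin.2.2, zero_mul]

/-- The momentum operator is no larger than the generator: `1 + 2πi P_B` is injective, having no
eigenvectors, while its restriction `1 - D` to the domain of the generator is onto. -/
theorem isGeneratedBy_group {B : Matrix (Fin 2) (Fin 2) ℂ} (hB : S.Represents B) :
    S.group.IsGeneratedBy (momentumOp α β B) := by
  have h2 : (2 * Real.pi * Complex.I : ℂ) ≠ 0 := Complex.two_pi_I_ne_zero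
  intro f g
  refine ⟨fun h => ?_, fun h =>
    (mem_graph_momentumOp α β B f g).2 (S.isMomentum_of_hasDerivAt hB h)⟩
  -- `x` lies in the domain of the generator, and `(1 + 2πi P_B) x = (1 + 2πi P_B) f`.
  obtain ⟨x, hx⟩ := S.group.exists_hasDerivAt_sub (f + (2 * Real.pi * Complex.I : ℂ) • g)
  set y : L2 α β := (2 * Real.pi * Complex.I : ℂ)⁻¹ • (f + (2 * Real.pi * Complex.I : ℂ) • g - x)
    with hy
  have hxy : HasDerivAt (fun t : ℝ => S.group.op t x) (-(2 * Real.pi * Complex.I) • y) 0 := by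
    refine hx.congr_deriv ?_
    rw [hy, neg_smul, smul_smul, mul_inv_cancel₀ h2, one_smul, neg_sub]
  have h3 := (mem_graph_momentumOp α β B x y).2 (S.isMomentum_of_hasDerivAt hB hxy)
  have h4 := (momentumOp α β B).graph.sub_mem h h3
  have h5 : g - y = (-(2 * Real.pi * Complex.I : ℂ)⁻¹) • (f - x) := by
    rw [hy, add_sub_right_comm, smul_add, smul_smul, inv_mul_cancel₀ h2, one_smul]
    module
  rw [Prod.mk_sub_mk, h5, mem_graph_momentumOp] at h4
  have h6 := S.eq_zero_of_isMomentum_smul hB h4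
  have hfx : f = x := sub_eq_zero.1 h6
  have hgy : g = y := by rw [h6, smul_zero] at h5; exact sub_eq_zero.1 h5
  rw [hfx, hgy]
  exact hxy

end Coupling

/-! ### The `L²` Fourier transform -/

theorem e_add (x y : ℝ) : e (x + y) = e x * e y := by
  rw [e, e, e, ← Complex.exp_add]; push_cast; ring_nf

theorem e_zero : e 0 = 1 := by simp [e]

theorem norm_e (x : ℝ) : ‖e x‖ = 1 := by
  rw [e, show (2 * Real.pi * Complex.I * x : ℂ) = ((2 * Real.pi * x : ℝ) : ℂ) * Complex.I by
    push_cast; ring]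
  exact Complex.norm_exp_ofReal_mul_I _

theorem conj_e (x : ℝ) : conj (e x) = e (-x) := by
  rw [e, e, ← Complex.exp_conj]
  simp only [map_mul, Complex.conj_ofReal, Complex.conj_I, Complex.conj_ofNat,
    Complex.ofReal_neg, mul_neg, neg_mul]

theorem continuous_e : Continuous e := by
  unfold e; fun_prop

theorem hasDerivAt_e (l x : ℝ) :
    HasDerivAt (fun x : ℝ => e (l * x)) (2 * Real.pi * Complex.I * l * e (l * x)) x := by
  have h0 : HasDerivAt (fun t : ℝ => 2 * Real.pi * Complex.I * l * (t : ℂ))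
      (2 * Real.pi * Complex.I * l * 1) x :=
    (Complex.ofRealCLM.hasDerivAt (x := x)).const_mul _
  refine (h0.cexp.congr_of_eventuallyEq (Eventually.of_forall fun t => ?_)).congr_deriv ?_
  · simp only [e]; push_cast; ring_nf
  · simp only [e]; push_cast; ring_nf

/-- The Fourier transform of `L²(ℝ)`. -/
abbrev fourierL2 : L2R ≃ₗᵢ[ℂ] L2R := Lp.fourierTransformₗᵢ ℝ ℂ

open FourierTransform in
/-- On integrable functions the inverse `L²` Fourier transform is given by the integral. -/
theorem coeFn_fourierL2_symm {G : L2R} (hG : Integrable G) :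
    fourierL2.symm G =ᵐ[volume] fun x => ∫ l, e (l * x) * G l := by
  have hker : (fun x : ℝ => ∫ l, e (l * x) * G l) = 𝓕⁻ (G : ℝ → ℂ) := by
    ext x
    rw [Real.fourierInv_eq']
    refine integral_congr_ae (Eventually.of_forall fun l => ?_)
    simp only [smul_eq_mul, e, RCLike.inner_apply, conj_trivial]
    congr 2
    push_cast; ring
  have hL : Continuous fun p : ℝ × ℝ => (-innerₗ ℝ) p.1 p.2 := by
    simp only [LinearMap.neg_apply, innerₗ_apply_apply]
    fun_prop
  have hcont : Continuous (𝓕⁻ (G : ℝ → ℂ)) :=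
    VectorFourier.fourierIntegral_continuous Real.continuous_fourierChar hL hG
  rw [hker]
  refine ae_eq_of_integral_contDiff_smul_eq ((Lp.memLp _).locallyIntegrable (by norm_num))
    hcont.locallyIntegrable fun g hg hgs => ?_
  have hg1 : HasCompactSupport fun x => (g x : ℂ) := hgs.comp_left (g := fun y : ℝ => (y : ℂ)) rfl
  have hg2 : ContDiff ℝ (⊤ : ℕ∞) fun x => (g x : ℂ) := Complex.ofRealCLM.contDiff.comp hg
  set φ : SchwartzMap ℝ ℂ := hg1.toSchwartzMap hg2 with hφ
  have hφg : ∀ x, φ x = (g x : ℂ) := fun x => rfl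
  have h1 := congrArg (fun T => T φ) (Lp.fourierInv_toTemperedDistribution_eq G)
  simp only [TemperedDistribution.fourierInv_apply, Lp.toTemperedDistribution_apply] at h1
  have h2 := VectorFourier.integral_fourierIntegral_smul_eq_flip (L := -innerₗ ℝ) (μ := volume)
    (ν := volume) Real.continuous_fourierChar hL φ.integrable hG
  have h3 : (-innerₗ ℝ).flip = -innerₗ ℝ := by
    ext; simp
  rw [h3] at h2
  have h4 : ∫ x, φ x • (fourierL2.symm G) x = ∫ x, φ x • 𝓕⁻ (G : ℝ → ℂ) x := by
    refine h1.symm.trans (Eq.trans ?_ h2)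
    refine integral_congr_ae (Eventually.of_forall fun x => ?_)
    simp only [SchwartzMap.fourierInv_coe]
    rfl
  simpa only [hφg, Complex.coe_smul] using h4

/-- Truncations converge in the mean. -/
theorem tendsto_eLpNorm_indicator_sub {μ : Measure ℝ} {f : ℝ → ℂ} (hf : MemLp f 2 μ) :
    Tendsto (fun R : ℝ => eLpNorm (fun x => (Icc (-R) R).indicator f x - f x) 2 μ) atTop
      (𝓝 0) := by
  have h0 : ∀ g : ℝ → ℂ, eLpNorm g 2 μ = (∫⁻ x, ‖g x‖ₑ ^ (2 : ℝ) ∂μ) ^ (1 / 2 : ℝ) := fun g => by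
    rw [eLpNorm_eq_lintegral_rpow_enorm_toReal (by norm_num) (by norm_num)]
    simp
  simp_rw [h0]
  have h1 : Tendsto (fun R : ℝ => ∫⁻ x, ‖(Icc (-R) R).indicator f x - f x‖ₑ ^ (2 : ℝ) ∂μ) atTop
      (𝓝 (∫⁻ _, 0 ∂μ)) := by
    refine tendsto_lintegral_filter_of_dominated_convergence' (fun x => ‖f x‖ₑ ^ (2 : ℝ))
      (Eventually.of_forall fun R => ?_) (Eventually.of_forall fun R =>
        Eventually.of_forall fun x => ?_) ?_ (Eventually.of_forall fun x => ?_)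
    · exact (((hf.1.indicator measurableSet_Icc).sub hf.1).enorm).pow_const _
    · by_cases hx : x ∈ Icc (-R) R <;> simp [hx]
    · have h2 := hf.2
      rw [h0] at h2
      intro h3
      rw [h3] at h2
      simp at h2
    · refine tendsto_const_nhds.congr' ?_
      filter_upwards [eventually_ge_atTop |x|] with R hR
      rw [indicator_of_mem (show x ∈ Icc (-R) R from abs_le.1 hR)]
      simp
  rw [lintegral_zero] at h1
  simpa using h1.ennrpow_const (1 / 2 : ℝ)

/-- The truncation of a square integrable function to `[-R, R]`. -/
def truncLp {μ : Measure ℝ} (f : Lp ℂ 2 μ) (R : ℝ) : Lp ℂ 2 μ :=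
  MemLp.toLp ((Icc (-R) R).indicator f) ((Lp.memLp f).indicator measurableSet_Icc)

theorem coeFn_truncLp {μ : Measure ℝ} (f : Lp ℂ 2 μ) (R : ℝ) :
    truncLp f R =ᵐ[μ] (Icc (-R) R).indicator f := by
  have h : MemLp ((Icc (-R) R).indicator f) 2 μ := (Lp.memLp f).indicator measurableSet_Icc
  exact h.coeFn_toLp

theorem tendsto_truncLp {μ : Measure ℝ} (f : Lp ℂ 2 μ) :
    Tendsto (truncLp f) atTop (𝓝 f) := by
  rw [Lp.tendsto_Lp_iff_tendsto_eLpNorm']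
  refine (tendsto_eLpNorm_indicator_sub (Lp.memLp f)).congr fun R => eLpNorm_congr_ae ?_
  filter_upwards [coeFn_truncLp f R] with x hx
  rw [Pi.sub_apply, hx]

theorem integrable_indicator_of_memLp {μ : Measure ℝ} {f : ℝ → ℂ} (hf : MemLp f 2 μ) {s : Set ℝ}
    (hs : MeasurableSet s) (hμ : μ s ≠ ∞) : Integrable (s.indicator f) μ := by
  rw [integrable_indicator_iff hs]
  have : IsFiniteMeasure (μ.restrict s) := ⟨by rwa [Measure.restrict_apply_univ, lt_top_iff_ne_top]⟩
  exact (hf.restrict s).integrable (by norm_num)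

theorem integrable_truncLp {μ : Measure ℝ} [IsFiniteMeasureOnCompacts μ] (f : Lp ℂ 2 μ) (R : ℝ) :
    Integrable (truncLp f R) μ :=
  (integrable_indicator_of_memLp (Lp.memLp f) measurableSet_Icc
    isCompact_Icc.measure_lt_top.ne).congr (coeFn_truncLp f R).symm

theorem memLp_e_mul (a : ℝ) (G : L2R) : MemLp (fun l => e (a * l) * G l) 2 volume := by
  refine (Lp.memLp G).of_le ((continuous_e.comp (continuous_const.mul
    continuous_id)).aestronglyMeasurable.mul (Lp.memLp G).1) (Eventually.of_forall fun l => ?_)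
  rw [norm_mul, norm_e, one_mul]

theorem fourierL2_symm_modulate (a : ℝ) (G : L2R) :
    fourierL2.symm (memLp_e_mul a G).toLp = translate a (fourierL2.symm G) := by
  set G' : L2R := (memLp_e_mul a G).toLp with hG'
  have h1 : ∀ R, fourierL2.symm (truncLp G' R) = translate a (fourierL2.symm (truncLp G R)) := by
    intro R
    refine Lp.ext ?_
    filter_upwards [coeFn_fourierL2_symm (integrable_truncLp G' R),
      coeFn_translate a (fourierL2.symm (truncLp G R)),
      ae_comp_add_right (coeFn_fourierL2_symm (integrable_truncLp G R)) a] with x h1 h2 h3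
    rw [h1, h2, h3]
    refine integral_congr_ae ?_
    filter_upwards [coeFn_truncLp G' R, coeFn_truncLp G R, (memLp_e_mul a G).coeFn_toLp]
      with l h4 h5 h6
    simp only [h4, h5, indicator]
    split_ifs
    · rw [h6, mul_add, e_add, mul_comm a l]; ring
    · simp
  have h2 : Tendsto (fun R => fourierL2.symm (truncLp G' R)) atTop (𝓝 (fourierL2.symm G')) :=
    (fourierL2.symm.continuous.tendsto _).comp (tendsto_truncLp G')
  have h3 : Tendsto (fun R => translate a (fourierL2.symm (truncLp G R))) atTop
      (𝓝 (translate a (fourierL2.symm G))) :=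
    (((translate a).continuous.comp fourierL2.symm.continuous).tendsto _).comp (tendsto_truncLp G)
  exact tendsto_nhds_unique h2 (h3.congr fun R => (h1 R).symm)

/-- The Fourier transform turns translations into multiplications by characters. -/
theorem coeFn_fourierL2_translate (a : ℝ) (u : L2R) :
    fourierL2 (translate a u) =ᵐ[volume] fun l => e (a * l) * fourierL2 u l := by
  have h := fourierL2_symm_modulate a (fourierL2 u)
  rw [LinearIsometryEquiv.symm_apply_apply] at h
  rw [← h, LinearIsometryEquiv.apply_symm_apply]
  exact (memLp_e_mul a (fourierL2 u)).coeFn_toLp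

namespace Coupling

variable {α β : ℝ} (S : Coupling α β)

/-! ### The generalized eigenfunctions and the spectral density -/

/-- The generalized eigenfunction: the plane wave `e(lx)` of the line, sewn to `Ω`. -/
def eigenfunction (l : ℝ) : ℝ → ℂ := S.sew fun x => e (l * x)

/-- The Fourier multiplier of `transfer`. -/
def symbol (l : ℝ) : ℂ := S.q * (e (α * l) - S.c * e l)

/-- The density of the spectral measure, a Poisson kernel. -/
def density (l : ℝ) : ℝ := poissonKernel 0 S.c (e ((α - 1) * l))

theorem continuous_symbol : Continuous S.symbol := by
  have := continuous_e
  unfold symbol; fun_prop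

theorem norm_symbol_le (l : ℝ) : ‖S.symbol l‖ ≤ ‖S.q‖ * 2 := by
  rw [symbol, norm_mul]
  refine mul_le_mul_of_nonneg_left ?_ (norm_nonneg _)
  refine (norm_sub_le _ _).trans ?_
  rw [norm_mul, norm_e, norm_e]
  linarith [S.norm_c_lt]

theorem norm_symbol (l : ℝ) : ‖S.symbol l‖ = ‖S.q‖ * ‖e ((α - 1) * l) - S.c‖ := by
  have h : e (α * l) - S.c * e l = (e ((α - 1) * l) - S.c) * e l := by
    rw [sub_mul, ← e_add]; ring_nf
  rw [symbol, norm_mul, h, norm_mul, norm_e, mul_one]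

theorem le_norm_symbol (l : ℝ) : ‖S.q‖ * (1 - ‖S.c‖) ≤ ‖S.symbol l‖ := by
  rw [norm_symbol]
  refine mul_le_mul_of_nonneg_left ?_ (norm_nonneg _)
  have := norm_sub_norm_le (e ((α - 1) * l)) S.c
  rwa [norm_e] at this

theorem lower_bound_pos : 0 < ‖S.q‖ * (1 - ‖S.c‖) :=
  mul_pos (norm_pos_iff.2 S.q_ne_zero) (by linarith [S.norm_c_lt])

/-- The density is the inverse square of the symbol. -/
theorem density_mul_norm_symbol_sq (l : ℝ) : S.density l * ‖S.symbol l‖ ^ 2 = 1 := by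
  have h : 0 < ‖S.symbol l‖ := S.lower_bound_pos.trans_le (S.le_norm_symbol l)
  rw [norm_symbol] at h ⊢
  have h1 : ‖e ((α - 1) * l) - S.c‖ ≠ 0 := right_ne_zero_of_mul h.ne'
  rw [density, poissonKernel_def, sub_zero, sub_zero, norm_e, mul_pow]
  field_simp
  linear_combination S.norm_q_sq

theorem density_pos (l : ℝ) : 0 < S.density l :=
  pos_of_mul_pos_left (by rw [S.density_mul_norm_symbol_sq]; exact one_pos) (sq_nonneg _)

theorem density_le (l : ℝ) : S.density l ≤ ((‖S.q‖ * (1 - ‖S.c‖)) ^ 2)⁻¹ := by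
  have h := S.lower_bound_pos
  rw [eq_inv_of_mul_eq_one_left (S.density_mul_norm_symbol_sq l)]
  exact inv_anti₀ (pow_pos h 2) (pow_le_pow_left₀ h.le (S.le_norm_symbol l) 2)

theorem measurable_density : Measurable S.density := by
  have : Continuous fun l : ℝ => e ((α - 1) * l) := continuous_e.comp (by fun_prop)
  have hm := this.measurable
  have h : S.density = fun l => (‖e ((α - 1) * l) - 0‖ ^ 2 - ‖S.c - 0‖ ^ 2) /
      ‖(e ((α - 1) * l) - 0) - (S.c - 0)‖ ^ 2 := by
    ext l; rw [density, poissonKernel_def]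
  rw [h]
  fun_prop

theorem periodic_density : Function.Periodic S.density (α - 1)⁻¹ := by
  intro l
  have h0 : α - 1 ≠ 0 := by linarith [S.one_lt]
  have h1 : e 1 = 1 := by simp [e]
  rw [density, density, mul_add, mul_inv_cancel₀ h0, e_add, h1, mul_one]

theorem measurable_eigenfunction : Measurable (Function.uncurry S.eigenfunction) := by
  have he := continuous_e.measurable
  have h : Function.uncurry S.eigenfunction = fun z : ℝ × ℝ =>
      if z.2 < 0 then S.p * (e (z.1 * (z.2 + 1)) - conj S.c * e (z.1 * (z.2 + α)))
      else if z.2 < α then e (z.1 * z.2)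
      else S.q * (e (z.1 * (z.2 + (α - β))) - S.c * e (z.1 * (z.2 + (1 - β)))) := by
    ext ⟨l, x⟩
    rfl
  rw [h]
  refine Measurable.ite (measurableSet_lt measurable_snd measurable_const) (by fun_prop)
    (Measurable.ite (measurableSet_lt measurable_snd measurable_const) (by fun_prop)
      (by fun_prop))

theorem norm_eigenfunction_le (l x : ℝ) :
    ‖S.eigenfunction l x‖ ≤ max (max (‖S.p‖ * 2) 1) (‖S.q‖ * 2) := by
  have hc := S.norm_c_lt
  have h2 : ∀ (y c : ℂ) (a b : ℝ), ‖c‖ < 1 → ‖y * (e a - c * e b)‖ ≤ ‖y‖ * 2 := by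
    intro y c a b hc
    rw [norm_mul]
    refine mul_le_mul_of_nonneg_left ((norm_sub_le _ _).trans ?_) (norm_nonneg _)
    rw [norm_mul, norm_e, norm_e]
    linarith
  simp only [eigenfunction, sew]
  split_ifs
  · exact (h2 _ _ _ _ (by rwa [RCLike.norm_conj])).trans
      ((le_max_left _ _).trans (le_max_left _ _))
  · rw [norm_e]
    exact (le_max_right _ _).trans (le_max_left _ _)
  · exact (h2 _ _ _ _ hc).trans (le_max_right _ _)

/-- Sewing an absolutely convergent superposition of plane waves superposes the
eigenfunctions. -/
theorem sew_integral {G : ℝ → ℂ} (hG : Integrable G) (x : ℝ) :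
    S.sew (fun x => ∫ l, e (l * x) * G l) x = ∫ l, S.eigenfunction l x * G l := by
  have hi : ∀ x : ℝ, Integrable fun l => e (l * x) * G l := fun x =>
    hG.bdd_mul (c := 1) (continuous_e.comp (continuous_id.mul
      continuous_const)).aestronglyMeasurable (Eventually.of_forall fun l => (norm_e _).le)
  have key : ∀ (y c : ℂ) (a b : ℝ), y * ((∫ l, e (l * a) * G l) - c * ∫ l, e (l * b) * G l) =
      ∫ l, y * (e (l * a) - c * e (l * b)) * G l := by
    intro y c a b
    rw [← integral_const_mul c, ← integral_sub (hi a) ((hi b).const_mul c), ← integral_const_mul]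
    refine integral_congr_ae (Eventually.of_forall fun l => ?_)
    simp only; ring
  simp only [eigenfunction, sew]
  split_ifs
  · exact key _ _ _ _
  · rfl
  · exact key _ _ _ _

theorem coeFn_sewEquiv_fourierL2_symm {G : L2R} (hG : Integrable G) :
    S.sewEquiv (fourierL2.symm G) =ᵐ[volume.restrict (Omega α β)]
      fun x => ∫ l, S.eigenfunction l x * G l := by
  have h := S.coeFn_sewLp_of_ae_eq (coeFn_fourierL2_symm hG)
  refine h.trans (Eventually.of_forall fun x => ?_)
  exact S.sew_integral hG x

theorem coeFn_fourierL2_transfer (u : L2R) :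
    fourierL2 (S.transfer u) =ᵐ[volume] fun l => S.symbol l * fourierL2 u l := by
  rw [transfer_apply, map_smul, map_sub, map_smul]
  filter_upwards [Lp.coeFn_smul S.q (fourierL2 (translate α u) - S.c • fourierL2 (translate 1 u)),
    Lp.coeFn_sub (fourierL2 (translate α u)) (S.c • fourierL2 (translate 1 u)),
    Lp.coeFn_smul S.c (fourierL2 (translate 1 u)),
    coeFn_fourierL2_translate α u, coeFn_fourierL2_translate 1 u] with l h1 h2 h3 h4 h5
  rw [h1, Pi.smul_apply, h2, Pi.sub_apply, h3, Pi.smul_apply, h4, h5, one_mul, symbol]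
  simp only [smul_eq_mul]; ring

/-! ### The eigenfunction transform -/

theorem norm_symbol_sq_mul_le (l : ℝ) (z : ℂ) :
    ‖((‖S.symbol l‖ ^ 2 : ℝ) : ℂ) * z‖ ≤ (‖S.q‖ * 2) ^ 2 * ‖z‖ := by
  rw [norm_mul, Complex.norm_real, Real.norm_of_nonneg (by positivity)]
  gcongr
  exact S.norm_symbol_le l

theorem memLp_symbol_sq_mul (G : L2R) :
    MemLp (fun l => ((‖S.symbol l‖ ^ 2 : ℝ) : ℂ) * G l) 2 volume := by
  have := S.continuous_symbol
  exact (Lp.memLp G).of_le_mul ((Continuous.aestronglyMeasurable (by fun_prop)).mul (Lp.memLp _).1)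
    (Eventually.of_forall fun l => S.norm_symbol_sq_mul_le l _)

/-- The eigenfunction transform of an integrable `f` is the Fourier transform of the function on
the line which is sewn into `f`, divided by the density. Both sides are paired with a sewn wave
packet `∫_s e(lx) dl`: Fubini's theorem evaluates one pairing, and Plancherel's theorem with
the isometry property of `transfer` the other. -/
theorem transform_ae_eq {f : L2 α β} (hf : Integrable f (volume.restrict (Omega α β))) :
    ∀ᵐ l, ∫ x in Omega α β, conj (S.eigenfunction l x) * f x =
      (‖S.symbol l‖ ^ 2 : ℝ) * fourierL2 (S.sewEquiv.symm f) l := by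
  set u := S.sewEquiv.symm f with hu
  set C := max (max (‖S.p‖ * 2) 1) (‖S.q‖ * 2) with hC
  have hmΨ : Measurable fun z : ℝ × ℝ => conj (S.eigenfunction z.1 z.2) :=
    Complex.continuous_conj.measurable.comp S.measurable_eigenfunction
  have hbΨ : ∀ z : ℝ × ℝ, ‖conj (S.eigenfunction z.1 z.2)‖ ≤ C := fun z => by
    rw [RCLike.norm_conj]; exact S.norm_eigenfunction_le _ _
  have hmem := S.memLp_symbol_sq_mul (fourierL2 u)
  have hTm : AEStronglyMeasurable
      (fun l => ∫ x in Omega α β, conj (S.eigenfunction l x) * f x) volume :=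
    AEStronglyMeasurable.integral_prod_right' (f := fun z : ℝ × ℝ =>
      conj (S.eigenfunction z.1 z.2) * f z.2) (hmΨ.aestronglyMeasurable.mul hf.1.comp_snd)
  refine ae_eq_of_forall_setIntegral_eq_of_sigmaFinite (fun s hs hμ => ?_) (fun s hs hμ => ?_)
    fun s hs hμ => ?_
  · have : IsFiniteMeasure (volume.restrict s) := ⟨by rwa [Measure.restrict_apply_univ]⟩
    refine Integrable.of_bound (C := C * ∫ x in Omega α β, ‖f x‖) hTm.restrict
      (Eventually.of_forall fun l => ?_)
    rw [← integral_const_mul]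
    refine norm_integral_le_of_norm_le (hf.norm.const_mul C) (Eventually.of_forall fun x => ?_)
    rw [norm_mul]
    exact mul_le_mul_of_nonneg_right (hbΨ (l, x)) (norm_nonneg _)
  · have : IsFiniteMeasure (volume.restrict s) := ⟨by rwa [Measure.restrict_apply_univ]⟩
    exact (hmem.restrict s).integrable (by norm_num)
  · set G : L2R := indicatorConstLp 2 hs hμ.ne (1 : ℂ) with hG
    have hGe : G =ᵐ[volume] s.indicator fun _ => (1 : ℂ) := indicatorConstLp_coeFn
    have hGi : Integrable G := by
      refine Integrable.congr ?_ hGe.symm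
      exact (integrable_indicator_iff hs).2 (integrableOn_const hμ.ne)
    have h1 : ⟪S.sewEquiv (fourierL2.symm G), f⟫_ℂ =
        ∫ l in s, ∫ x in Omega α β, conj (S.eigenfunction l x) * f x := by
      have e1 : ∀ x, ∫ l, S.eigenfunction l x * G l = ∫ l in s, S.eigenfunction l x := by
        intro x
        rw [← integral_indicator hs]
        refine integral_congr_ae ?_
        filter_upwards [hGe] with l hl
        rw [hl]
        simp only [indicator]
        split_ifs <;> simp
      have hprod : Integrable (Function.uncurry fun l x => conj (S.eigenfunction l x) * f x)
          ((volume.restrict s).prod (volume.restrict (Omega α β))) := by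
        have : IsFiniteMeasure (volume.restrict s) := ⟨by rwa [Measure.restrict_apply_univ]⟩
        refine Integrable.bdd_mul (c := C) (hf.comp_snd (volume.restrict s))
          hmΨ.aestronglyMeasurable (Eventually.of_forall hbΨ)
      rw [integral_integral_swap hprod, L2.inner_def]
      refine integral_congr_ae ?_
      filter_upwards [S.coeFn_sewEquiv_fourierL2_symm hGi] with x hx
      rw [hx, e1, RCLike.inner_apply', ← integral_conj, integral_mul_const]
    have h2 : ⟪S.sewEquiv (fourierL2.symm G), f⟫_ℂ =
        ∫ l in s, ((‖S.symbol l‖ ^ 2 : ℝ) : ℂ) * fourierL2 u l := by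
      have hfu : f = S.sewEquiv u := (S.sewEquiv.apply_symm_apply f).symm
      rw [hfu]
      change ⟪S.sewLp (fourierL2.symm G), S.sewLp u⟫_ℂ = _
      rw [inner_sewLp, ← fourierL2.inner_map_map, L2.inner_def, ← integral_indicator hs]
      refine integral_congr_ae ?_
      filter_upwards [S.coeFn_fourierL2_transfer (fourierL2.symm G),
        S.coeFn_fourierL2_transfer u, hGe] with l h3 h4 h5
      rw [h3, h4, LinearIsometryEquiv.apply_symm_apply, h5, RCLike.inner_apply']
      simp only [indicator]
      split_ifs
      · rw [mul_one, ← mul_assoc, Complex.conj_mul']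
        push_cast; rfl
      · simp
    rw [← h1, h2]

/-! ### The eigenfunction expansion -/

theorem spectralMeasure_density_le : spectralMeasure S.density ≤
    ENNReal.ofReal ((‖S.q‖ * (1 - ‖S.c‖)) ^ 2)⁻¹ • (volume : Measure ℝ) := by
  rw [spectralMeasure, ← withDensity_const]
  exact withDensity_mono (Eventually.of_forall fun l => ENNReal.ofReal_le_ofReal (S.density_le l))

theorem tendsto_truncTransform (f : L2 α β) :
    Tendsto (fun R : ℝ => eLpNorm (fun l => truncTransform α β S.eigenfunction f R l -
      ((‖S.symbol l‖ ^ 2 : ℝ) : ℂ) * fourierL2 (S.sewEquiv.symm f) l) 2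
      (spectralMeasure S.density)) atTop (𝓝 0) := by
  set K : L2 α β → L2R := fun f => fourierL2 (S.sewEquiv.symm f) with hK
  have hKc : Continuous K := fourierL2.continuous.comp S.sewEquiv.symm.continuous
  set C : ℝ≥0∞ := ENNReal.ofReal ((‖S.q‖ * (1 - ‖S.c‖)) ^ 2)⁻¹ with hC
  set D : ℝ := (‖S.q‖ * 2) ^ 2 with hD
  have h1 : Tendsto (fun R => eLpNorm (K (truncLp f R) - K f : ℝ → ℂ) 2 volume) atTop (𝓝 0) :=
    (Lp.tendsto_Lp_iff_tendsto_eLpNorm' _ _).1 ((hKc.tendsto f).comp (tendsto_truncLp f))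
  have h2 : ∀ R, eLpNorm (fun l => truncTransform α β S.eigenfunction f R l -
      ((‖S.symbol l‖ ^ 2 : ℝ) : ℂ) * K f l) 2 (spectralMeasure S.density) ≤
      C ^ (1 / (2 : ℝ≥0∞)).toReal * (ENNReal.ofReal D *
        eLpNorm (K (truncLp f R) - K f : ℝ → ℂ) 2 volume) := by
    intro R
    refine (eLpNorm_mono_measure _ S.spectralMeasure_density_le).trans ?_
    rw [eLpNorm_smul_measure_of_ne_top (by norm_num), smul_eq_mul]
    gcongr
    refine eLpNorm_le_mul_eLpNorm_of_ae_le_mul ?_ 2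
    filter_upwards [S.transform_ae_eq (integrable_truncLp f R)] with l hl
    have h3 : truncTransform α β S.eigenfunction f R l =
        ∫ x in Omega α β, conj (S.eigenfunction l x) * truncLp f R x := by
      rw [truncTransform, ← setIntegral_indicator measurableSet_Icc]
      refine integral_congr_ae ?_
      filter_upwards [coeFn_truncLp f R] with x hx
      rw [hx]
      simp only [indicator]
      split_ifs <;> simp
    rw [h3, hl, ← mul_sub]
    exact S.norm_symbol_sq_mul_le l _
  have h3 : Tendsto (fun R => C ^ (1 / (2 : ℝ≥0∞)).toReal * (ENNReal.ofReal D *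
        eLpNorm (K (truncLp f R) - K f : ℝ → ℂ) 2 volume)) atTop (𝓝 0) := by
    have h4 := ENNReal.Tendsto.const_mul (a := ENNReal.ofReal D) h1 (Or.inr ENNReal.ofReal_ne_top)
    have h5 := ENNReal.Tendsto.const_mul (a := C ^ (1 / (2 : ℝ≥0∞)).toReal) h4
      (Or.inr (ENNReal.rpow_ne_top_of_nonneg (by positivity) ENNReal.ofReal_ne_top))
    simpa using h5
  exact tendsto_of_tendsto_of_tendsto_of_le_of_le tendsto_const_nhds h3 (fun _ => bot_le) h2

theorem tendsto_truncExpansion (f : L2 α β) (t : ℝ) :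
    Tendsto (fun R : ℝ => eLpNorm (fun x => truncExpansion S.eigenfunction S.density
      (fun l => ((‖S.symbol l‖ ^ 2 : ℝ) : ℂ) * fourierL2 (S.sewEquiv.symm f) l) t R x -
        S.group.op t f x) 2 (volume.restrict (Omega α β))) atTop (𝓝 0) := by
  set u := S.sewEquiv.symm f with hu
  set G : L2R := (memLp_e_mul (-t) (fourierL2 u)).toLp with hG
  have hGe : G =ᵐ[volume] fun l => e (-t * l) * fourierL2 u l :=
    (memLp_e_mul (-t) (fourierL2 u)).coeFn_toLp
  have h1 : S.group.op t f = S.sewEquiv (fourierL2.symm G) := by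
    rw [group_op, hG, fourierL2_symm_modulate, LinearIsometryEquiv.symm_apply_apply]
  have hc : Continuous fun G : L2R => S.sewEquiv (fourierL2.symm G) :=
    S.sewEquiv.continuous.comp fourierL2.symm.continuous
  have h2 := (Lp.tendsto_Lp_iff_tendsto_eLpNorm' _ _).1 ((hc.tendsto G).comp (tendsto_truncLp G))
  refine h2.congr fun R => eLpNorm_congr_ae ?_
  filter_upwards [S.coeFn_sewEquiv_fourierL2_symm (integrable_truncLp G R)] with x hx
  rw [Pi.sub_apply, h1, Function.comp_apply, hx, truncExpansion,
    ← integral_indicator measurableSet_Icc]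
  congr 1
  refine integral_congr_ae ?_
  filter_upwards [coeFn_truncLp G R, hGe] with l h3 h4
  rw [h3]
  simp only [indicator]
  split_ifs
  · have h5 : ((‖S.symbol l‖ ^ 2 : ℝ) : ℂ) * (S.density l : ℂ) = 1 := by
      rw [mul_comm]; exact_mod_cast S.density_mul_norm_symbol_sq l
    rw [h4, show -(l * t) = -t * l by ring]
    linear_combination (-(e (-t * l) * fourierL2 u l * S.eigenfunction l x)) * h5
  · simp

theorem hasEigenfunctionExpansion_group :
    HasEigenfunctionExpansion α β S.group S.eigenfunction S.density := fun f =>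
  ⟨fun l => ((‖S.symbol l‖ ^ 2 : ℝ) : ℂ) * fourierL2 (S.sewEquiv.symm f) l,
    (S.memLp_symbol_sq_mul _).of_measure_le_smul ENNReal.ofReal_ne_top S.spectralMeasure_density_le,
    S.tendsto_truncTransform f, S.tendsto_truncExpansion f⟩

/-! ### The eigenvalue equation -/

theorem eigenfunction_of_neg (l : ℝ) {x : ℝ} (hx : x < 0) :
    S.eigenfunction l x = S.p * (e l - conj S.c * e (l * α)) * e (l * x) := by
  rw [eigenfunction, S.sew_of_neg _ hx]
  simp only [mul_add, e_add, mul_one]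
  ring

theorem eigenfunction_of_mem_Ioo (l : ℝ) {x : ℝ} (hx : x ∈ Ioo 1 α) :
    S.eigenfunction l x = e (l * x) := S.sew_of_mem_Ioo _ hx

theorem eigenfunction_of_gt (l : ℝ) {x : ℝ} (hx : β < x) :
    S.eigenfunction l x = S.q * (e (l * α) - S.c * e l) * e (-(l * β)) * e (l * x) := by
  rw [eigenfunction, S.sew_of_gt _ hx]
  simp only [mul_add, sub_eq_add_neg, e_add, mul_one, mul_neg]
  ring

/-- Integration by parts on the three components: the boundary terms cancel, since the plane wave
and the test function satisfy the same unitary boundary condition. -/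
theorem isBoundedGeneralizedEigenfunction {B : Matrix (Fin 2) (Fin 2) ℂ} (hB : S.Represents B)
    (l : ℝ) : IsBoundedGeneralizedEigenfunction α β B l (S.eigenfunction l) := by
  have hα := S.one_lt
  refine ⟨S.measurable_eigenfunction.comp measurable_prodMk_left,
    ⟨_, fun x _ => S.norm_eigenfunction_le l x⟩, ?_, ?_⟩
  · intro h
    have h1 : ∀ᵐ x ∂(volume.restrict (Ioo 1 α)), S.eigenfunction l x = 0 :=
      ae_mono (Measure.restrict_mono (fun x hx => Or.inl (Or.inr hx)) le_rfl) h
    have h2 : ∀ᵐ _x ∂(volume.restrict (Ioo 1 α)), False := by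
      filter_upwards [h1, ae_restrict_mem measurableSet_Ioo] with x hx hx'
      rw [S.eigenfunction_of_mem_Ioo l hx'] at hx
      have := norm_e (l * x)
      rw [hx, norm_zero] at this
      exact zero_ne_one this
    rw [eventually_false_iff_eq_bot, ae_eq_bot, Measure.restrict_eq_zero, Real.volume_Ioo,
      ENNReal.ofReal_eq_zero] at h2
    linarith
  · rintro η ⟨hη, hηs, hηB⟩
    have h0 := hηB 0
    simp only [iteratedDeriv_zero] at h0
    obtain ⟨e0, eβ⟩ := (hB _ _ _ _).1 h0
    set G : ℝ → ℂ := fun x => η x * e (-l * x) with hG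
    have hηd : ∀ x, HasDerivAt η (deriv η x) x := fun x =>
      (hη.differentiable (by norm_num) x).hasDerivAt
    have hGd : ∀ x, deriv G x =
        (deriv η x - 2 * Real.pi * Complex.I * l * η x) * e (-l * x) := fun x =>
      ((hηd x).mul (hasDerivAt_e (-l) x)).deriv.trans (by push_cast; ring)
    have hes : ContDiff ℝ 1 fun x : ℝ => e (-l * x) := by
      have : ContDiff ℝ 1 (fun x : ℝ => (x : ℂ)) := Complex.ofRealCLM.contDiff
      unfold e
      push_cast
      fun_prop
    have hGc : ContDiff ℝ 1 G := (hη.of_le (by exact_mod_cast le_top)).mul hes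
    have hGs : HasCompactSupport G := hηs.mul_right
    have hηi : Integrable η := hη.continuous.integrable_of_hasCompactSupport hηs
    have hdηi : Integrable (deriv η) :=
      (hη.continuous_deriv (by norm_num)).integrable_of_hasCompactSupport hηs.deriv
    have hΨ : AEStronglyMeasurable (fun x => conj (S.eigenfunction l x)) volume :=
      (Complex.continuous_conj.measurable.comp
        (S.measurable_eigenfunction.comp measurable_prodMk_left)).aestronglyMeasurable
    have hmul : ∀ {k : ℝ → ℂ}, Integrable k →
        Integrable fun x => k x * conj (S.eigenfunction l x) := fun hk =>
      hk.mul_bdd hΨ (Eventually.of_forall fun x => by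
        rw [RCLike.norm_conj]; exact S.norm_eigenfunction_le l x)
    set k : ℝ → ℂ := fun x => deriv η x - 2 * Real.pi * Complex.I * l * η x with hk
    have hki : Integrable k := hdηi.sub (hηi.const_mul _)
    have main : ∫ x in Omega α β, k x * conj (S.eigenfunction l x) = 0 := by
      rw [setIntegral_Omega S.one_lt S.lt (hmul hki).integrableOn]
      have i1 : ∫ x in Iio 0, k x * conj (S.eigenfunction l x) =
          conj (S.p * (e l - conj S.c * e (l * α))) * η 0 := by
        have h1 := HasCompactSupport.integral_Iic_deriv_eq hGc hGs 0
        rw [integral_Iic_eq_integral_Iio] at h1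
        rw [show η 0 = G 0 by simp [hG, e_zero], ← h1, ← integral_const_mul]
        refine setIntegral_congr_fun measurableSet_Iio fun x hx => ?_
        rw [S.eigenfunction_of_neg l hx, hGd, map_mul (starRingEnd ℂ) (S.p * _), conj_e, neg_mul]
        ring
      have i2 : ∫ x in Ioo 1 α, k x * conj (S.eigenfunction l x) =
          η α * e (-l * α) - η 1 * e (-l) := by
        have h1 : ∫ x in (1 : ℝ)..α, deriv G x = G α - G 1 :=
          intervalIntegral.integral_deriv_eq_sub (fun x _ => hGc.differentiable (by norm_num) x)
            ((hGc.continuous_deriv le_rfl).intervalIntegrable _ _)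
        rw [intervalIntegral.integral_of_le hα.le, integral_Ioc_eq_integral_Ioo] at h1
        simp only [hG, mul_one] at h1
        rw [← h1]
        refine setIntegral_congr_fun measurableSet_Ioo fun x hx => ?_
        have h2 := hGd x
        simp only [hG] at h2
        rw [S.eigenfunction_of_mem_Ioo l hx, h2, conj_e, neg_mul]
      have i3 : ∫ x in Ioi β, k x * conj (S.eigenfunction l x) =
          -(conj (S.q * (e (l * α) - S.c * e l)) * η β) := by
        have h1 := HasCompactSupport.integral_Ioi_deriv_eq hGc hGs β
        have h2 : conj (S.q * (e (l * α) - S.c * e l)) * η β =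
            conj (S.q * (e (l * α) - S.c * e l) * e (-(l * β))) * G β := by
          have h3 : e (l * β) * e (-(l * β)) = 1 := by rw [← e_add, add_neg_cancel, e_zero]
          simp only [hG, map_mul, conj_e, neg_neg, neg_mul]
          linear_combination (-(conj S.q * conj (e (l * α) - S.c * e l) * η β)) * h3
        rw [h2, ← mul_neg, ← h1, ← integral_const_mul]
        refine setIntegral_congr_fun measurableSet_Ioi fun x hx => ?_
        rw [S.eigenfunction_of_gt l hx, hGd,
          map_mul (starRingEnd ℂ) (S.q * (e (l * α) - S.c * e l) * e (-(l * β))) (e (l * x)),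
          conj_e (l * x), neg_mul]
        ring
      have hp : S.p * conj S.p * (1 - S.c * conj S.c) = 1 := by
        rw [Complex.mul_conj', Complex.mul_conj']; exact_mod_cast S.norm_p_sq
      have hq : S.q * conj S.q * (1 - S.c * conj S.c) = 1 := by
        rw [Complex.mul_conj', Complex.mul_conj']; exact_mod_cast S.norm_q_sq
      have hc : (1 - S.c * conj S.c) ≠ 0 := fun h => by simp [h] at hp
      have hpq : S.q * conj S.q = S.p * conj S.p := mul_right_cancel₀ hc (hq.trans hp.symm)
      rw [i1, i2, i3, e0, eβ]
      simp only [map_mul, map_sub, conj_e, Complex.conj_conj, neg_mul]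
      linear_combination (e (-l) * η 1 - e (-(l * α)) * η α) * hp -
        (e (-(l * α)) - conj S.c * e (-l)) * (η α - S.c * η 1) * hpq
    have h2 : (2 * Real.pi * Complex.I : ℂ) ≠ 0 := Complex.two_pi_I_ne_zero
    have m1 : ∫ x in Omega α β, k x * conj (S.eigenfunction l x) =
        (∫ x in Omega α β, deriv η x * conj (S.eigenfunction l x)) -
          2 * Real.pi * Complex.I * l * ∫ x in Omega α β, η x * conj (S.eigenfunction l x) := by
      rw [← integral_const_mul, ← integral_sub (hmul hdηi).integrableOn
        ((hmul hηi).const_mul _).integrableOn]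
      refine integral_congr_ae (Eventually.of_forall fun x => ?_)
      simp only [hk]; ring
    rw [main] at m1
    simp only [mul_assoc (2 * Real.pi * Complex.I : ℂ)⁻¹]
    rw [integral_const_mul, sub_eq_zero.1 m1.symm]
    field_simp

end Coupling

/-! ### The coupling of a boundary matrix -/

/-- The coupling with which the boundary condition of `boundaryMatrix w θ φ ψ` is solved for the
values at `0` and `β`. Dividing by `w` is what excludes `w = 0`. -/
def couplingOfMatrix {α β w : ℝ} (θ φ ψ : ℝ) (hα : 1 < α) (hαβ : α < β) (hw0 : 0 < w)
    (hw1 : w ≤ 1) : Coupling α β where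
  c := (Real.sqrt (1 - w ^ 2) : ℝ) * e ψ
  p := (w : ℂ)⁻¹ * e φ
  q := (w : ℂ)⁻¹ * e (φ - θ)
  one_lt := hα
  lt := hαβ
  norm_c_lt := by
    rw [norm_mul, norm_e, mul_one, Complex.norm_real, Real.norm_of_nonneg (Real.sqrt_nonneg _),
      Real.sqrt_lt' one_pos]
    have := pow_pos hw0 2
    linarith
  norm_p_sq := by
    have h : 0 ≤ 1 - w ^ 2 := by nlinarith
    rw [norm_mul, norm_mul, norm_e, norm_e, norm_inv, Complex.norm_real, Complex.norm_real,
      Real.norm_of_nonneg hw0.le, Real.norm_of_nonneg (Real.sqrt_nonneg _), mul_one, mul_one,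
      Real.sq_sqrt h]
    field_simp
    ring
  norm_q_sq := by
    have h : 0 ≤ 1 - w ^ 2 := by nlinarith
    rw [norm_mul, norm_mul, norm_e, norm_e, norm_inv, Complex.norm_real, Complex.norm_real,
      Real.norm_of_nonneg hw0.le, Real.norm_of_nonneg (Real.sqrt_nonneg _), mul_one, mul_one,
      Real.sq_sqrt h]
    field_simp
    ring

theorem represents_couplingOfMatrix {α β w : ℝ} (θ φ ψ : ℝ) (hα : 1 < α) (hαβ : α < β)
    (hw0 : 0 < w) (hw1 : w ≤ 1) :
    (couplingOfMatrix θ φ ψ hα hαβ hw0 hw1).Represents (boundaryMatrix w θ φ ψ) := by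
  intro v₀ v₁ vα vβ
  have hw : (w : ℂ) ≠ 0 := by exact_mod_cast hw0.ne'
  have hr : ((Real.sqrt (1 - w ^ 2) : ℝ) : ℂ) ^ 2 = 1 - (w : ℂ) ^ 2 := by
    have h : Real.sqrt (1 - w ^ 2) ^ 2 = 1 - w ^ 2 := Real.sq_sqrt (by nlinarith)
    exact_mod_cast h
  have hinv : ∀ x, e x * e (-x) = 1 := fun x => by rw [← e_add, add_neg_cancel, e_zero]
  have hm : boundaryMatrix w θ φ ψ *ᵥ ![v₁, vβ] = ![v₀, vα] ↔
      (w : ℂ) * e φ * v₁ + -((Real.sqrt (1 - w ^ 2) : ℝ) : ℂ) * e (θ - ψ) * vβ = v₀ ∧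
      ((Real.sqrt (1 - w ^ 2) : ℝ) : ℂ) * e ψ * v₁ + (w : ℂ) * e (θ - φ) * vβ = vα := by
    rw [funext_iff, Fin.forall_fin_two]
    simp [boundaryMatrix, Matrix.mulVec, dotProduct, Fin.sum_univ_two]
  rw [hm]
  simp only [couplingOfMatrix, map_mul, conj_e, Complex.conj_ofReal]
  generalize ((Real.sqrt (1 - w ^ 2) : ℝ) : ℂ) = r at *
  have hθφ := hinv (θ - φ)
  rw [neg_sub] at hθφ
  have key : e (θ - ψ) * e (φ - θ) = e φ * e (-ψ) := by rw [← e_add, ← e_add]; ring_nf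
  have hψ := hinv ψ
  have h2 : r * e ψ * v₁ + (w : ℂ) * e (θ - φ) * vβ = vα ↔
      vβ = (w : ℂ)⁻¹ * e (φ - θ) * (vα - r * e ψ * v₁) := by
    constructor
    · intro h
      rw [← h]
      field_simp
      linear_combination (-vβ * w) * hθφ
    · intro h
      rw [h]
      field_simp
      linear_combination (vα - r * e ψ * v₁) * hθφ
  rw [h2]
  refine and_congr_left fun h => ?_
  have h3 : (w : ℂ) * e φ * v₁ + -r * e (θ - ψ) * vβ =
      (w : ℂ)⁻¹ * e φ * (v₁ - r * e (-ψ) * vα) := by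
    rw [h]
    field_simp
    linear_combination (-r * (vα - r * e ψ * v₁)) * key + r ^ 2 * v₁ * e φ * hψ + e φ * v₁ * hr
  rw [h3]
  exact eq_comm

end ExteriorMomentum

end

open ExteriorMomentum in
theorem theorem2p1 (α β : ℝ) (hα : 1 < α) (hαβ : α < β)
    (B : Matrix.unitaryGroup (Fin 2) ℂ) (w θ φ ψ : ℝ) (hw0 : 0 < w) (hw1 : w ≤ 1)
    (hB : (B : Matrix (Fin 2) (Fin 2) ℂ) = boundaryMatrix w θ φ ψ) :
    ∃ (Ψ : ℝ → ℝ → ℂ) (F : ℝ → ℝ),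
      -- the generalized eigenfunctions: bounded, normalized on the middle interval
      Measurable (Function.uncurry Ψ) ∧
      (∃ C : ℝ, ∀ l : ℝ, ∀ x ∈ Omega α β, ‖Ψ l x‖ ≤ C) ∧
      (∀ l : ℝ, IsBoundedGeneralizedEigenfunction α β B l (Ψ l)) ∧
      (∀ l : ℝ, ∀ x ∈ Set.Ioo 1 α, Ψ l x = e (l * x)) ∧
      -- the density: positive, Borel, periodic, a Poisson kernel on each period
      Measurable F ∧ (∀ l : ℝ, 0 < F l) ∧
      Function.Periodic F (α - 1)⁻¹ ∧
      (∀ l : ℝ, F l = poissonKernel 0 ((Real.sqrt (1 - w ^ 2) : ℝ) * e ψ) (e ((α - 1) * l))) ∧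
      -- the unitary group generated by the momentum operator exists and has the expansion
      (∃ U : UnitaryGroup (L2 α β), U.IsGeneratedBy (momentumOp α β B)) ∧
      (∀ U : UnitaryGroup (L2 α β), U.IsGeneratedBy (momentumOp α β B) →
        HasEigenfunctionExpansion α β U Ψ F) ∧
      -- there are no bound states
      (∀ (z : ℂ) (f : L2 α β), (f, z • f) ∈ (momentumOp α β B).graph → f = 0) := by
  set S := couplingOfMatrix θ φ ψ hα hαβ hw0 hw1 with hS
  have hSB : S.Represents (B : Matrix (Fin 2) (Fin 2) ℂ) := by
    rw [hB]; exact represents_couplingOfMatrix θ φ ψ hα hαβ hw0 hw1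
  have hgen := S.isGeneratedBy_group hSB
  refine ⟨S.eigenfunction, S.density, S.measurable_eigenfunction,
    ⟨_, fun l x _ => S.norm_eigenfunction_le l x⟩, S.isBoundedGeneralizedEigenfunction hSB,
    fun l x hx => S.eigenfunction_of_mem_Ioo l hx, S.measurable_density, S.density_pos,
    S.periodic_density, fun l => rfl, ⟨S.group, hgen⟩, fun U hU f => ?_, fun z f h =>
      S.eq_zero_of_isMomentum_smul hSB ((mem_graph_momentumOp α β B f (z • f)).1 h)⟩
  obtain ⟨g, hg1, hg2, hg3⟩ := S.hasEigenfunctionExpansion_group f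
  refine ⟨g, hg1, hg2, fun t => ?_⟩
  rw [UnitaryGroup.op_eq_of_isGeneratedBy hU hgen t f]
  exact hg3 t
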